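/- Let $\Omega\subset\mathbb{R}^2$ be the open unit disk and let $\sigma\in L^\infty(\Omega)$ be real valued, strictly positive ($\sigma\ge c$ a.e. for some $c>0$), rotationally symmetric ($\sigma(z)=\sigma(|z|)$), with $\sigma\equiv 1$ close to $\partial\Omega$. Write $L^2_\diamond(\partial\Omega)$ for the real mean-free functions in $L^2(\partial\Omega)$. For $\kappa\in\{\sigma,1\}$ let $\mathcal{R}_\kappa$ be the Neumann-to-Dirichlet map $\mathcal{R}_\kappa\psi=u|_{\partial\Omega}$ on $L^2_\diamond(\partial\Omega)$, where $u\in H^1(\Omega)$ is the weak solution of $\nabla\cdot\kappa\nabla u=0$ in $\Omega$, $\kappa\,\partial_\nu u=\psi$ on $\partial\Omega$, $\int_{\partial\Omega}u\,ds=0$. Put $\mathcal{R}_{\sigma,1}=\mathcal{R}_\sigma-\mathcal{R}_1$. Let $E_1,\dots,E_M\subset\partial\Omega$ be mutually disjoint, nonempty, connected, open electrodes of equal length $|E|$, with characteristic functions $\chi_m$, and let $\widetilde E_1,\dots,\widetilde E_M\subset\partial\Omega$ be mutually disjoint, nonempty, connected, open sets with $E_m\subset\overline{\widetilde E_m}$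 and $\bigcup_m\overline{\widetilde E_m}=\partial\Omega$. Put $$Q\varphi=\sum_{m=1}^M\frac{\chi_m}{|E_m|}\int_{\widetilde E_m}\varphi\,ds .$$ Let $N$ be even with $N<M$, let $\mathcal{N}=\{-N/2,\dots,-1,1,\dots,N/2\}$, and put $\varphi_n(\theta)=\pi^{-1/2}\sin(n\theta)$ for $n<0$ and $\varphi_n(\theta)=\pi^{-1/2}\cos(n\theta)$ for $n>0$. Write $\psi_n=Q\varphi_n$, $g_n=\mathcal{R}_{\sigma,1}\psi_n$, $(\hat\psi_n)_j=(\psi_n,\varphi_j)_{L^2(\partial\Omega)}$, $(\hat g_n)_j=(g_n,\varphi_j)_{L^2(\partial\Omega)}$ for $n,j\in\mathcal{N}$. Let $\Psi\in\mathbb{R}^{N^2\times N^2}$ be the matrix obtained by stacking, over $n\in\mathcal N$, the block diagonal matrices $\Psi_n\in\mathbb{R}^{N\times N^2}$ with $N$ diagonal blocks all equal to the row $\hat\psi_n^T$, and assume that $\Psi$ has full rank. Fix one $n\in\mathcal{N}$ and assume that $(\hat\psi_n)_j\neq 0$ for all $j\in\mathcal{N}$. Then $\mathcal{R}_\sigma$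 and $\mathcal{R}_1$ are well defined on $L^2_\diamond(\partial\Omega)$, $\psi_n\in L^2_\diamond(\partial\Omega)$, and the difference ND matrix $\mathbf{R}_{\sigma,1}=\big((\mathcal{R}_{\sigma,1}\varphi_k,\varphi_j)_{L^2(\partial\Omega)}\big)_{k,j\in\mathcal N}$ of order $N$ is recovered from the single measurement $g_n$: with $$c_j=\frac{(\hat g_n)_j}{(\hat\psi_n)_j},\qquad j\in\mathcal{N},$$ one has $\mathcal{R}_{\sigma,1}\varphi_j=c_j\varphi_j$ for every $j\in\mathcal{N}$, and $\mathbf{R}_{\sigma,1}=\operatorname{diag}\big((c_j)_{j\in\mathcal{N}}\big)$. -/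

import Mathlib

open MeasureTheory Filter Topology
open scoped Real ContDiff

noncomputable section

namespace EIT

/-! ### The unit disk and its boundary

The plane `ℝ²` is identified with `ℂ` (regarded as a real inner product space), `Ω` is the open unit
disk, and `∂Ω` is parametrized by the angle `θ ∈ ℝ / 2πℤ`.  The measure `volume` on `AddCircle (2π)`
has total mass `2π`, so it is the arc length of the unit circle. -/

/-- Lebesgue measure on the open unit disk. -/
abbrev diskMeasure : Measure ℂ := volume.restrict (Metric.ball (0 : ℂ) 1)

instance factTwoPiPos : Fact (0 < 2 * π) := ⟨Real.two_pi_pos⟩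

/-- The boundary of the unit disk, parametrized by the angle. -/
abbrev Bdry : Type := AddCircle (2 * π)

/-- The point `(cos θ, sin θ)` of the unit circle. -/
def bdryPoint (θ : Bdry) : ℂ := (AddCircle.toCircle θ : ℂ)

/-- `L²(∂Ω)`, real valued. -/
abbrev L2Bdry : Type := Lp ℝ 2 (volume : Measure Bdry)

/-- `L²(Ω)`, real valued. -/
abbrev L2Disk : Type := Lp ℝ 2 diskMeasure

/-- `L²(Ω; ℝ²)`. -/
abbrev L2DiskVec : Type := Lp ℂ 2 diskMeasure

/-- Membership of `L²_⋄(∂Ω)`: the function has mean zero. -/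
def MeanFree (f : L2Bdry) : Prop := ∫ θ, f θ = 0

/-! ### The Sobolev space `H¹(Ω)` and traces -/

/-- `G` is the weak gradient of `u` in `Ω`; thus `u ∈ H¹(Ω)` with `∇u = G`. -/
def HasWeakGradient (u : L2Disk) (G : L2DiskVec) : Prop :=
  ∀ η : ℂ → ℝ, ContDiff ℝ ∞ η → HasCompactSupport η → tsupport η ⊆ Metric.ball (0 : ℂ) 1 →
    ∫ z, u z • gradient η z ∂diskMeasure = -∫ z, η z • G z ∂diskMeasure

/-- `g ∈ L²(∂Ω)` is the trace of `u ∈ H¹(Ω)`, where `G = ∇u`.  The trace is the continuous extension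
of the restriction `w ↦ w|_∂Ω` from functions that are smooth up to the boundary: `u` is the `H¹`
limit of such functions whose boundary values converge to `g` in `L²(∂Ω)`. -/
def HasTrace (u : L2Disk) (G : L2DiskVec) (g : L2Bdry) : Prop :=
  ∃ w : ℕ → ℂ → ℝ, (∀ k, ContDiff ℝ ∞ (w k)) ∧
    Tendsto (fun k => eLpNorm (fun z => w k z - u z) 2 diskMeasure) atTop (𝓝 0) ∧
    Tendsto (fun k => eLpNorm (fun z => gradient (w k) z - G z) 2 diskMeasure) atTop (𝓝 0) ∧
    Tendsto (fun k => eLpNorm (fun θ : Bdry => w k (bdryPoint θ) - g θ) 2 volume) atTop (𝓝 0)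

/-! ### Conductivities and the Neumann-to-Dirichlet map -/

/-- `σ ∈ L^∞(Ω)` is strictly positive (essentially bounded away from zero). -/
structure IsConductivity (σ : ℂ → ℝ) : Prop where
  aemeasurable : AEMeasurable σ diskMeasure
  bounded : ∃ C : ℝ, ∀ᵐ z ∂diskMeasure, σ z ≤ C
  positive : ∃ c : ℝ, 0 < c ∧ ∀ᵐ z ∂diskMeasure, c ≤ σ z

/-- `σ` is rotationally symmetric: it only depends on `|z|`. -/
def IsRotationallySymmetric (σ : ℂ → ℝ) : Prop :=
  ∃ ρ : ℝ → ℝ, ∀ᵐ z ∂diskMeasure, σ z = ρ ‖z‖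

/-- `σ ≡ 1` close to the boundary of the disk. -/
def IsOneNearBoundary (σ : ℂ → ℝ) : Prop :=
  ∃ r : ℝ, r < 1 ∧ ∀ᵐ z ∂diskMeasure, r < ‖z‖ → σ z = 1

/-- `u ∈ H¹(Ω)`, with `∇u = G`, is a weak solution of `∇ · σ∇u = 0` in `Ω`, `σ ∂_ν u = ψ` on `∂Ω`:
for all `v ∈ H¹(Ω)`, with gradient `F` and trace `h`, `∫_Ω σ ∇u · ∇v = ∫_∂Ω ψ v`. -/
def IsNeumannSolution (σ : ℂ → ℝ) (ψ : L2Bdry) (u : L2Disk) (G : L2DiskVec) : Prop :=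
  HasWeakGradient u G ∧
    ∀ (v : L2Disk) (F : L2DiskVec) (h : L2Bdry), HasWeakGradient v F → HasTrace v F h →
      ∫ z, σ z * inner ℝ (G z) (F z) ∂diskMeasure = ∫ θ, ψ θ * h θ

/-- `g` is the boundary voltage generated by the current `ψ`: it is the trace of a weak solution of
the Neumann problem, normalized by `∫_∂Ω g = 0`. -/
def IsVoltage (σ : ℂ → ℝ) (ψ g : L2Bdry) : Prop :=
  MeanFree g ∧ ∃ (u : L2Disk) (G : L2DiskVec), IsNeumannSolution σ ψ u G ∧ HasTrace u G g

open Classical in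
/-- The ND map `R_σ : ψ ↦ u|_∂Ω`.  (Where there is no solution, in particular if `ψ` is not mean
free, the value is `0` by convention.) -/
def ndMap (σ : ℂ → ℝ) (ψ : L2Bdry) : L2Bdry :=
  if h : ∃ g, IsVoltage σ ψ g then h.choose else 0

/-- The difference map `R_{σ,1} = R_σ - R_1`. -/
def ndDiff (σ : ℂ → ℝ) (ψ : L2Bdry) : L2Bdry := ndMap σ ψ - ndMap (fun _ => 1) ψ

/-! ### Trigonometric basis -/

/-- `φ_n(θ) = sin(nθ)/√π` for `n < 0` and `φ_n(θ) = cos(nθ)/√π` for `n > 0`, written with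
`fourier n θ = exp(inθ)`. -/
def trigFun (n : ℤ) : C(Bdry, ℝ) where
  toFun θ := 1 / √π * (if n < 0 then (fourier n θ : ℂ).im else (fourier n θ : ℂ).re)
  continuous_toFun := by
    split_ifs <;> fun_prop

theorem trigFun_coe (n : ℤ) (θ : ℝ) :
    trigFun n (θ : Bdry) = 1 / √π * (if n < 0 then Real.sin (n * θ) else Real.cos (n * θ)) := by
  have h : (fourier n (θ : Bdry) : ℂ) = Complex.exp (((n * θ : ℝ) : ℂ) * Complex.I) := by
    rw [fourier_coe_apply]
    congr 1
    have : (π : ℂ) ≠ 0 := by exact_mod_cast Real.pi_ne_zero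
    push_cast
    field_simp
  simp only [trigFun, ContinuousMap.coe_mk, h, Complex.exp_ofReal_mul_I_re,
    Complex.exp_ofReal_mul_I_im]

/-- `φ_n` as an element of `L²(∂Ω)`. -/
def basisFun (n : ℤ) : L2Bdry := ContinuousMap.toLp 2 volume ℝ (trigFun n)

/-- The index set `𝒩 = {-N/2, …, -1, 1, …, N/2}`. -/
def indexSet (N : ℕ) : Finset ℤ := (Finset.Icc (-((N / 2 : ℕ) : ℤ)) ((N / 2 : ℕ) : ℤ)).erase 0

/-- The coefficient `(f, φ_j)_{L²(∂Ω)}`. -/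
def coeff (f : L2Bdry) (j : ℤ) : ℝ := inner ℝ f (basisFun j)

/-- The difference ND matrix of order `N`, with entries `(R_{σ,1} φ_n, φ_j)_{L²(∂Ω)}`. -/
def ndMatrix (σ : ℂ → ℝ) (N : ℕ) : Matrix (indexSet N) (indexSet N) ℝ :=
  Matrix.of fun n j => coeff (ndDiff σ (basisFun n)) j

/-! ### Electrodes -/

/-- `M` electrodes `E_m` of equal size together with extended electrodes `Ẽ_m`. -/
structure ElectrodeArray (M : ℕ) where
  /-- the electrodes -/
  E : Fin M → Set Bdry
  /-- the extended electrodes -/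
  Ext : Fin M → Set Bdry
  isOpen_E : ∀ m, IsOpen (E m)
  isConnected_E : ∀ m, IsConnected (E m)
  disjoint_E : Pairwise fun m m' => Disjoint (E m) (E m')
  sameSize : ∀ m m', volume (E m) = volume (E m')
  isOpen_Ext : ∀ m, IsOpen (Ext m)
  isConnected_Ext : ∀ m, IsConnected (Ext m)
  disjoint_Ext : Pairwise fun m m' => Disjoint (Ext m) (Ext m')
  subset_closure : ∀ m, E m ⊆ closure (Ext m)
  cover : ⋃ m, closure (Ext m) = Set.univ

/-- The nonorthogonal projection `Qφ = ∑_m (χ_m / |E_m|) ∫_{Ẽ_m} φ ds`, where `χ_m` is the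
characteristic function of `E_m`. -/
def ElectrodeArray.Q {M : ℕ} (A : ElectrodeArray M) (φ : L2Bdry) : L2Bdry :=
  ∑ m, (((volume : Measure Bdry).real (A.E m))⁻¹ * ∫ θ in A.Ext m, φ θ) •
    indicatorConstLp 2 (A.isOpen_E m).measurableSet (measure_ne_top volume (A.E m)) (1 : ℝ)

/-- The current `ψ_n = Q φ_n`. -/
def ElectrodeArray.current {M : ℕ} (A : ElectrodeArray M) (n : ℤ) : L2Bdry := A.Q (basisFun n)

/-- The `N² × N²` matrix `Ψ` made of the stacked blocks `Ψ_n`, `n ∈ 𝒩`, where `Ψ_n` is the block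
diagonal matrix with `N` copies of the row `ψ̂_nᵀ`. The row `(n, k)` is row `k` of `Ψ_n`, and the
column `(l, j)` belongs to the entry `(l, j)` of the unknown matrix. -/
def ElectrodeArray.Psi {M : ℕ} (A : ElectrodeArray M) (N : ℕ) :
    Matrix (indexSet N × indexSet N) (indexSet N × indexSet N) ℝ :=
  Matrix.of fun nk lj => if nk.2 = lj.1 then coeff (A.current nk.1) lj.2 else 0

end EIT

end

/-!
The energy form `∫_Ω σ ∇u · ∇v` is symmetric, so `R_σ` is self-adjoint, and it is invariant under
rotations, so `R_σ` commutes with translations of the angle. The translates of `φ_j` are combinations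
of `φ_j` and `φ_{-j}` with coefficients `cos jα` and `sin jα`; hence the translates of `R_σ φ_j` are
the same combinations of `R_σ φ_j` and `R_σ φ_{-j}`, which forces `R_σ φ_j` to lie in the span of `φ_j`
and `φ_{-j}` (`exists_eq_of_shift_eq`). Self-adjointness removes the `φ_{-j}` component, so `φ_j` is an
eigenfunction of `R_σ` (`exists_ndMap_basisFun`), and likewise of `R_1`. If `R_{σ,1} φ_j = c φ_j`, then
self-adjointness gives `(R_{σ,1} ψ, φ_j) = c (ψ, φ_j)` for every mean free `ψ`, so that `c` is read off
from one measurement as soon as `(ψ, φ_j) ≠ 0` (`ndDiff_basisFun_eq`).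

Well-posedness of the Neumann problem rests on the inequality
`‖u‖² + ‖∇u‖² + ‖u|_∂Ω‖² ≤ C ‖∇u‖²` for `u` with mean zero on the boundary (`norm_sq_centerL_le`). It is
proved for smooth functions in polar coordinates (`polar_poincare`) by joining two boundary points
through a radial segment, an arc of radius `r` and a radial segment, and averaging over `r`; it extends
to the closure of the smooth triples `(w, ∇w, w|_∂Ω)`, which by `hasTrace_iff` is exactly the set of
triples described by `HasTrace`. The Lax–Milgram theorem on the mean free part of this closure then
gives existence, and coercivity gives uniqueness.

The current `Q φ` is mean free because a connected open subset of the circle has a null frontier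
(`volume_frontier_eq_zero`), so that the extended electrodes cover the circle up to a null set.
-/

noncomputable section

namespace EIT

/-! ### A Poincaré inequality in polar coordinates -/

theorem sq_intervalIntegral_le {g : ℝ → ℝ} {a b : ℝ} (hab : a ≤ b) (hg : Continuous g) :
    (∫ x in a..b, g x) ^ 2 ≤ (b - a) * ∫ x in a..b, g x ^ 2 := by
  rcases hab.eq_or_lt with rfl | h
  · simp
  have hL : 0 < b - a := sub_pos.2 h
  set I := ∫ x in a..b, g x with hI
  have h0 : 0 ≤ ∫ x in a..b, (g x - I / (b - a)) ^ 2 :=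
    intervalIntegral.integral_nonneg hab fun _ _ => sq_nonneg _
  have h1 : ∫ x in a..b, (g x - I / (b - a)) ^ 2
      = (∫ x in a..b, g x ^ 2) - 2 * (I / (b - a)) * I + (b - a) * (I / (b - a)) ^ 2 := by
    have : ∀ x, (g x - I / (b - a)) ^ 2
        = g x ^ 2 - 2 * (I / (b - a)) * g x + (I / (b - a)) ^ 2 := fun x => by ring
    simp_rw [this]
    rw [intervalIntegral.integral_add, intervalIntegral.integral_sub,
      intervalIntegral.integral_const_mul, intervalIntegral.integral_const, smul_eq_mul] <;>
    exact Continuous.intervalIntegrable (by fun_prop) _ _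
  have h2 : (b - a) * ((∫ x in a..b, g x ^ 2) - 2 * (I / (b - a)) * I + (b - a) * (I / (b - a)) ^ 2)
      = (b - a) * (∫ x in a..b, g x ^ 2) - I ^ 2 := by
    field_simp
    ring
  have := mul_nonneg hL.le (h1 ▸ h0)
  linarith

theorem continuous_intervalIntegral_of_uncurry {F : ℝ → ℝ → ℝ}
    (hF : Continuous (Function.uncurry F)) (a b : ℝ) :
    Continuous fun x => ∫ y in a..b, F x y :=
  intervalIntegral.continuous_parametric_intervalIntegral_of_continuous' hF a b

theorem intervalIntegral_swap_of_continuous {F : ℝ → ℝ → ℝ} (hF : Continuous (Function.uncurry F))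
    (a b c d : ℝ) :
    ∫ x in a..b, ∫ y in c..d, F x y = ∫ y in c..d, ∫ x in a..b, F x y := by
  refine intervalIntegral_intervalIntegral_swap ?_
  exact (hF.continuousOn.integrableOn_compact (isCompact_uIcc.prod isCompact_uIcc)).mono_set
    (Set.prod_mono Set.uIoc_subset_uIcc Set.uIoc_subset_uIcc)

section Polar

variable {f fr ft E : ℝ → ℝ → ℝ}

theorem intervalIntegral_le_of_subset {g : ℝ → ℝ} {a b c d : ℝ} (hca : c ≤ a) (hab : a ≤ b)
    (hbd : b ≤ d) (hg : Continuous g) (h0 : ∀ x ∈ Set.Icc c d, 0 ≤ g x) :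
    ∫ x in a..b, g x ≤ ∫ x in c..d, g x := by
  refine intervalIntegral.integral_mono_interval hca hab hbd ?_ (hg.intervalIntegrable _ _)
  filter_upwards [ae_restrict_mem measurableSet_Ioc] with x hx
  exact h0 x (Set.Ioc_subset_Icc_self hx)

/-- The factor `r` on the left is absorbed by the weight `s ≥ r` of the polar volume element, so the
bound holds down to the origin. Here `E` stands for `|∇w|²` in polar coordinates. -/
theorem radial_increment_sq_le (hr : ∀ r θ, HasDerivAt (fun s => f s θ) (fr r θ) r)
    (cr : Continuous (Function.uncurry fr)) (cE : Continuous (Function.uncurry E))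
    (hrE : ∀ r θ, fr r θ ^ 2 ≤ E r θ) {r : ℝ} (h0 : 0 ≤ r) (h1 : r ≤ 1) (θ : ℝ) :
    r * (f 1 θ - f r θ) ^ 2 ≤ ∫ s in 0..1, s * E s θ := by
  have cr' : Continuous fun s => fr s θ := cr.comp (by fun_prop : Continuous fun s : ℝ => (s, θ))
  have cE' : Continuous fun s => E s θ := cE.comp (by fun_prop : Continuous fun s : ℝ => (s, θ))
  have hE0 : ∀ s, 0 ≤ E s θ := fun s => (sq_nonneg _).trans (hrE s θ)
  have e1 : f 1 θ - f r θ = ∫ s in r..1, fr s θ :=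
    (intervalIntegral.integral_eq_sub_of_hasDerivAt (fun s _ => hr s θ)
      (cr'.intervalIntegrable _ _)).symm
  have e2 := sq_intervalIntegral_le h1 cr'
  have e3 : r * ∫ s in r..1, fr s θ ^ 2 ≤ ∫ s in r..1, s * E s θ := by
    rw [← intervalIntegral.integral_const_mul]
    refine intervalIntegral.integral_mono_on h1 (Continuous.intervalIntegrable (by fun_prop) _ _)
      (Continuous.intervalIntegrable (by fun_prop) _ _) fun s hs => ?_
    exact mul_le_mul hs.1 (hrE s θ) (sq_nonneg _) (h0.trans hs.1)
  have e4 : ∫ s in r..1, s * E s θ ≤ ∫ s in 0..1, s * E s θ :=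
    intervalIntegral_le_of_subset h0 h1 le_rfl (by fun_prop) fun s hs => mul_nonneg hs.1 (hE0 s)
  have e5 : 0 ≤ ∫ s in r..1, fr s θ ^ 2 :=
    intervalIntegral.integral_nonneg h1 fun _ _ => sq_nonneg _
  rw [e1]
  calc r * (∫ s in r..1, fr s θ) ^ 2 ≤ r * ((1 - r) * ∫ s in r..1, fr s θ ^ 2) := by gcongr
    _ ≤ r * (1 * ∫ s in r..1, fr s θ ^ 2) := by gcongr; linarith
    _ ≤ _ := by rw [one_mul]; exact e3.trans e4

/-- The bound along an arc. Since `r ≤ 1`, the factor `r²` of the squared angular derivative may be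
replaced by the weight `r` of the polar volume element. -/
theorem angular_increment_sq_le (ht : ∀ r θ, HasDerivAt (fun t => f r t) (ft r θ) θ)
    (ct : Continuous (Function.uncurry ft)) (cE : Continuous (Function.uncurry E))
    (hE0 : ∀ r θ, 0 ≤ E r θ)
    (htE : ∀ r θ, ft r θ ^ 2 ≤ r ^ 2 * E r θ) {r : ℝ} (h0 : 0 ≤ r) (h1 : r ≤ 1) {θ θ' : ℝ}
    (hθ : θ ∈ Set.Icc (-π) π) (hθ' : θ' ∈ Set.Icc (-π) π) :
    (f r θ - f r θ') ^ 2 ≤ 2 * π * ∫ t in -π..π, r * E r t := by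
  wlog hle : θ' ≤ θ generalizing θ θ'
  · rw [← neg_sub, neg_sq]; exact this hθ' hθ (le_of_not_ge hle)
  have ct' : Continuous fun s => ft r s := ct.comp (by fun_prop : Continuous fun s : ℝ => (r, s))
  have cE' : Continuous fun s => E r s := cE.comp (by fun_prop : Continuous fun s : ℝ => (r, s))
  have e1 : f r θ - f r θ' = ∫ s in θ'..θ, ft r s :=
    (intervalIntegral.integral_eq_sub_of_hasDerivAt (fun s _ => ht r s)
      (ct'.intervalIntegrable _ _)).symm
  have e2 := sq_intervalIntegral_le hle ct'
  have e3 : ∫ s in θ'..θ, ft r s ^ 2 ≤ ∫ s in θ'..θ, r * E r s := by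
    refine intervalIntegral.integral_mono_on hle (Continuous.intervalIntegrable (by fun_prop) _ _)
      (Continuous.intervalIntegrable (by fun_prop) _ _) fun s hs => (htE r s).trans ?_
    exact mul_le_mul_of_nonneg_right (by nlinarith) (hE0 r s)
  have e4 : ∫ s in θ'..θ, r * E r s ≤ ∫ s in -π..π, r * E r s :=
    intervalIntegral_le_of_subset hθ'.1 hle hθ.2 (by fun_prop) fun s hs => mul_nonneg h0 (hE0 r s)
  have e5 : 0 ≤ ∫ s in θ'..θ, ft r s ^ 2 :=
    intervalIntegral.integral_nonneg hle fun _ _ => sq_nonneg _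
  rw [e1]
  refine e2.trans (mul_le_mul ?_ (e3.trans e4) e5 (by positivity))
  linarith [hθ.2, hθ'.1]

/-- A pointwise bound on boundary values of mean zero: the first integral is the energy along the ray
of angle `θ`, the second one the total energy. -/
theorem boundary_sq_le (hr : ∀ r θ, HasDerivAt (fun s => f s θ) (fr r θ) r)
    (ht : ∀ r θ, HasDerivAt (fun t => f r t) (ft r θ) θ)
    (cf : Continuous (Function.uncurry f))
    (cr : Continuous (Function.uncurry fr)) (ct : Continuous (Function.uncurry ft))
    (cE : Continuous (Function.uncurry E))
    (hrE : ∀ r θ, fr r θ ^ 2 ≤ E r θ) (htE : ∀ r θ, ft r θ ^ 2 ≤ r ^ 2 * E r θ)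
    (hmean : ∫ t in -π..π, f 1 t = 0) {θ : ℝ} (hθ : θ ∈ Set.Icc (-π) π) :
    f 1 θ ^ 2 ≤ 6 * (∫ s in 0..1, s * E s θ) + 50 * ∫ t in -π..π, ∫ s in 0..1, s * E s t := by
  have hE0 : ∀ r θ, 0 ≤ E r θ := fun r θ => (sq_nonneg _).trans (hrE r θ)
  have crE : Continuous (Function.uncurry fun r t => r * E r t) := by
    have : Continuous fun p : ℝ × ℝ => p.1 * Function.uncurry E p := by fun_prop
    exact this
  have crE' : Continuous (Function.uncurry fun t r => r * E r t) := crE.comp continuous_swap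
  set P : ℝ → ℝ := fun t => ∫ s in 0..1, s * E s t with hP
  have cP : Continuous P := continuous_intervalIntegral_of_uncurry crE' 0 1
  set A := ∫ t in -π..π, P t with hA
  set q : ℝ → ℝ := fun r => ∫ t in -π..π, r * E r t with hq
  have cq : Continuous q := continuous_intervalIntegral_of_uncurry crE (-π) π
  have hqA : ∫ r in 0..1, q r = A := intervalIntegral_swap_of_continuous crE 0 1 (-π) π
  have hpi := Real.pi_pos
  have hq0 : ∀ r, 0 ≤ r → 0 ≤ q r := fun r h =>
    intervalIntegral.integral_nonneg (by linarith) fun t _ => mul_nonneg h (hE0 r t)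
  have hqA' : ∫ r in (1/2 : ℝ)..1, q r ≤ A := by
    rw [← hqA]
    exact intervalIntegral_le_of_subset (by norm_num) (by norm_num) le_rfl cq fun r h => hq0 r h.1
  have cf1 : Continuous fun t => f 1 t := cf.comp (by fun_prop : Continuous fun s : ℝ => ((1:ℝ), s))
  -- a radial segment, an arc of radius `r` and a radial segment join the boundary points `θ` and `t`;
  -- the resulting bound is averaged over `1/2 ≤ r ≤ 1`
  have key : ∀ t ∈ Set.Icc (-π) π, (f 1 θ - f 1 t) ^ 2 ≤ 6 * P θ + 6 * P t + 12 * π * A := by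
    intro t ht'
    have h1 : ∀ r ∈ Set.Icc (1/2 : ℝ) 1,
        (f 1 θ - f 1 t) ^ 2 ≤ 6 * P θ + 6 * P t + 6 * π * q r := by
      intro r hr'
      have h0 : 0 ≤ r := by linarith [hr'.1]
      have a1 := radial_increment_sq_le hr cr cE hrE h0 hr'.2 θ
      have a2 := radial_increment_sq_le hr cr cE hrE h0 hr'.2 t
      have a3 := angular_increment_sq_le ht ct cE hE0 htE h0 hr'.2 hθ ht'
      change _ ≤ P θ at a1
      change _ ≤ P t at a2
      change _ ≤ 2 * π * q r at a3
      have b1 : (f 1 θ - f r θ) ^ 2 ≤ 2 * P θ := by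
        nlinarith [mul_nonneg (sub_nonneg.2 hr'.1) (sq_nonneg (f 1 θ - f r θ))]
      have b2 : (f 1 t - f r t) ^ 2 ≤ 2 * P t := by
        nlinarith [mul_nonneg (sub_nonneg.2 hr'.1) (sq_nonneg (f 1 t - f r t))]
      have b3 : (f 1 θ - f 1 t) ^ 2 ≤
          3 * ((f 1 θ - f r θ) ^ 2 + (f 1 t - f r t) ^ 2 + (f r θ - f r t) ^ 2) := by
        nlinarith [sq_nonneg ((f 1 θ - f r θ) + (f 1 t - f r t)),
          sq_nonneg ((f 1 θ - f r θ) - (f r θ - f r t)),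
          sq_nonneg ((f 1 t - f r t) + (f r θ - f r t))]
      linarith
    have h2 := intervalIntegral.integral_mono_on (by norm_num : (1/2 : ℝ) ≤ 1)
      (Continuous.intervalIntegrable (by fun_prop) _ _)
      (Continuous.intervalIntegrable (by fun_prop) _ _) h1 (μ := volume)
    rw [intervalIntegral.integral_const, intervalIntegral.integral_add
      (Continuous.intervalIntegrable (by fun_prop) _ _)
      (Continuous.intervalIntegrable (by fun_prop) _ _), intervalIntegral.integral_const,
      intervalIntegral.integral_const_mul, smul_eq_mul, smul_eq_mul] at h2
    nlinarith
  have h3 := intervalIntegral.integral_mono_on (by linarith : -π ≤ π)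
      (Continuous.intervalIntegrable (by fun_prop) _ _)
      (Continuous.intervalIntegrable (by fun_prop) _ _) key (μ := volume)
  have h4 : ∫ t in -π..π, (f 1 θ - f 1 t) ^ 2 = 2 * π * f 1 θ ^ 2 + ∫ t in -π..π, f 1 t ^ 2 := by
    have : ∀ t, (f 1 θ - f 1 t) ^ 2 = f 1 θ ^ 2 - 2 * f 1 θ * f 1 t + f 1 t ^ 2 := fun t => by ring
    simp_rw [this]
    rw [intervalIntegral.integral_add (Continuous.intervalIntegrable (by fun_prop) _ _)
      (Continuous.intervalIntegrable (by fun_prop) _ _), intervalIntegral.integral_sub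
      (Continuous.intervalIntegrable (by fun_prop) _ _)
      (Continuous.intervalIntegrable (by fun_prop) _ _), intervalIntegral.integral_const_mul,
      hmean, intervalIntegral.integral_const, smul_eq_mul]
    ring
  have h5 : 0 ≤ ∫ t in -π..π, f 1 t ^ 2 :=
    intervalIntegral.integral_nonneg (by linarith) fun _ _ => sq_nonneg _
  have h6 : ∫ t in -π..π, (6 * P θ + 6 * P t + 12 * π * A)
      = 2 * π * (6 * P θ + 12 * π * A) + 6 * A := by
    rw [intervalIntegral.integral_add (Continuous.intervalIntegrable (by fun_prop) _ _)
      (Continuous.intervalIntegrable (by fun_prop) _ _), intervalIntegral.integral_add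
      (Continuous.intervalIntegrable (by fun_prop) _ _)
      (Continuous.intervalIntegrable (by fun_prop) _ _), intervalIntegral.integral_const,
      intervalIntegral.integral_const, intervalIntegral.integral_const_mul, smul_eq_mul,
      smul_eq_mul]
    ring
  rw [h4, h6] at h3
  have hA0 : 0 ≤ A := by
    rw [← hqA]; exact intervalIntegral.integral_nonneg (by norm_num) fun r h => hq0 r h.1
  have h7 : π * f 1 θ ^ 2 ≤ π * (6 * P θ + 12 * π * A) + 3 * A := by linarith
  have h8 : π * (12 * π * A) ≤ π * (48 * A) := by
    have := Real.pi_le_four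
    gcongr
    linarith
  have h9 : 3 * A ≤ π * (1 * A) := by nlinarith [Real.pi_gt_three]
  have h10 : π * f 1 θ ^ 2 ≤ π * (6 * P θ + 50 * A) := by nlinarith
  exact le_of_mul_le_mul_left h10 hpi

/-- Trace and Poincaré inequality in polar coordinates: `f` is a function with radial derivative `fr`
and angular derivative `ft`, and `E` bounds the squared norm of its gradient. -/
theorem polar_poincare (hr : ∀ r θ, HasDerivAt (fun s => f s θ) (fr r θ) r)
    (ht : ∀ r θ, HasDerivAt (fun t => f r t) (ft r θ) θ)
    (cf : Continuous (Function.uncurry f))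
    (cr : Continuous (Function.uncurry fr)) (ct : Continuous (Function.uncurry ft))
    (cE : Continuous (Function.uncurry E))
    (hrE : ∀ r θ, fr r θ ^ 2 ≤ E r θ) (htE : ∀ r θ, ft r θ ^ 2 ≤ r ^ 2 * E r θ)
    (hmean : ∫ t in -π..π, f 1 t = 0) :
    (∫ t in -π..π, f 1 t ^ 2) ≤ 500 * ∫ t in -π..π, ∫ s in 0..1, s * E s t ∧
    (∫ t in -π..π, ∫ s in 0..1, s * f s t ^ 2) ≤ 1500 * ∫ t in -π..π, ∫ s in 0..1, s * E s t := by
  have hpi := Real.pi_pos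
  have hE0 : ∀ r θ, 0 ≤ E r θ := fun r θ => (sq_nonneg _).trans (hrE r θ)
  have crE' : Continuous (Function.uncurry fun t r => r * E r t) := by
    have : Continuous fun p : ℝ × ℝ => p.2 * Function.uncurry E p.swap := by fun_prop
    exact this
  have crf : Continuous (Function.uncurry fun t r => r * f r t ^ 2) := by
    have : Continuous fun p : ℝ × ℝ => p.2 * Function.uncurry f p.swap ^ 2 := by fun_prop
    exact this
  have key := fun θ hθ => boundary_sq_le hr ht cf cr ct cE hrE htE hmean (θ := θ) hθ
  set P : ℝ → ℝ := fun t => ∫ s in 0..1, s * E s t with hP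
  have cP : Continuous P := continuous_intervalIntegral_of_uncurry crE' 0 1
  have cf1 : Continuous fun t => f 1 t := cf.comp (by fun_prop : Continuous fun s : ℝ => ((1:ℝ), s))
  set A := ∫ t in -π..π, P t with hA
  have hA0 : 0 ≤ A := intervalIntegral.integral_nonneg (by linarith) fun t _ =>
    intervalIntegral.integral_nonneg (by norm_num) fun s hs => mul_nonneg hs.1 (hE0 s t)
  have h1 : (∫ t in -π..π, f 1 t ^ 2) ≤ 500 * A := by
    have h3 := intervalIntegral.integral_mono_on (by linarith : -π ≤ π)
      (Continuous.intervalIntegrable (by fun_prop) _ _)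
      (Continuous.intervalIntegrable (by fun_prop) _ _) key (μ := volume)
    rw [intervalIntegral.integral_add (Continuous.intervalIntegrable (by fun_prop) _ _)
      (Continuous.intervalIntegrable (by fun_prop) _ _), intervalIntegral.integral_const_mul,
      intervalIntegral.integral_const, smul_eq_mul, ← hA] at h3
    nlinarith [Real.pi_le_four]
  refine ⟨h1, ?_⟩
  have h2 : ∀ t ∈ Set.Icc (-π) π, ∫ s in 0..1, s * f s t ^ 2 ≤ 2 * f 1 t ^ 2 + 2 * P t := by
    intro t _
    have c2 : Continuous fun s => s * f s t ^ 2 :=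
      crf.comp (by fun_prop : Continuous fun s : ℝ => (t, s))
    have h3 : ∀ s ∈ Set.Icc (0:ℝ) 1, s * f s t ^ 2 ≤ 2 * f 1 t ^ 2 + 2 * P t := by
      intro s hs
      have a1 := radial_increment_sq_le hr cr cE hrE hs.1 hs.2 t
      change _ ≤ P t at a1
      nlinarith [mul_nonneg hs.1 (sq_nonneg (f s t - 2 * f 1 t)),
        mul_nonneg (sub_nonneg.2 hs.2) (sq_nonneg (f 1 t))]
    have h4 := intervalIntegral.integral_mono_on (by norm_num : (0:ℝ) ≤ 1)
      (c2.intervalIntegrable _ _)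
      (Continuous.intervalIntegrable (by fun_prop) _ _) h3 (μ := volume)
    rwa [intervalIntegral.integral_const, sub_zero, one_smul] at h4
  have cQ : Continuous fun t => ∫ s in 0..1, s * f s t ^ 2 :=
    continuous_intervalIntegral_of_uncurry crf 0 1
  have h5 := intervalIntegral.integral_mono_on (by linarith : -π ≤ π)
    (cQ.intervalIntegrable _ _)
    (Continuous.intervalIntegrable (by fun_prop) _ _) h2 (μ := volume)
  rw [intervalIntegral.integral_add (Continuous.intervalIntegrable (by fun_prop) _ _)
      (Continuous.intervalIntegrable (by fun_prop) _ _), intervalIntegral.integral_const_mul,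
      intervalIntegral.integral_const_mul, ← hA] at h5
  linarith

end Polar

/-! ### The Poincaré inequality on the disk -/

instance isFiniteMeasure_diskMeasure : IsFiniteMeasure diskMeasure :=
  ⟨by simp [diskMeasure]⟩

/-- The point with polar coordinates `(r, t)`. -/
def polarPoint (r t : ℝ) : ℂ := r * (Real.cos t + Real.sin t * Complex.I)

theorem continuous_polarPoint : Continuous (Function.uncurry polarPoint) := by
  have : Continuous fun p : ℝ × ℝ =>
      (p.1 : ℂ) * ((Real.cos p.2 : ℝ) + (Real.sin p.2 : ℝ) * Complex.I) := by fun_prop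
  exact this

theorem bdryPoint_coe (t : ℝ) : bdryPoint (t : Bdry) = polarPoint 1 t := by
  have h : 2 * π / (2 * π) * t = t := by
    have := Real.pi_pos
    field_simp
  rw [bdryPoint, AddCircle.toCircle_apply_mk, h, Circle.coe_exp, Complex.exp_mul_I, polarPoint]
  simp

theorem continuous_bdryPoint : Continuous bdryPoint := by
  unfold bdryPoint
  exact continuous_subtype_val.comp AddCircle.continuous_toCircle

theorem integral_bdry_eq (g : Bdry → ℝ) : ∫ θ, g θ = ∫ t in -π..π, g (t : Bdry) := by
  rw [← AddCircle.intervalIntegral_preimage (2 * π) (-π) g]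
  congr 1
  ring

theorem norm_polarPoint {r : ℝ} (hr : 0 < r) (t : ℝ) : ‖polarPoint r t‖ = r := by
  have : polarPoint r t = r * Complex.exp (t * Complex.I) := by
    rw [Complex.exp_mul_I, polarPoint]
    simp
  rw [this, norm_mul, Complex.norm_exp_ofReal_mul_I]
  simp [abs_of_pos hr]

theorem integral_disk_eq {F : ℂ → ℝ} (hF : Continuous F) :
    ∫ z, F z ∂diskMeasure = ∫ t in -π..π, ∫ s in 0..1, s * F (polarPoint s t) := by
  have hc : Continuous (Function.uncurry fun r t => r * F (polarPoint r t)) := by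
    have : Continuous fun p : ℝ × ℝ => p.1 * F (Function.uncurry polarPoint p) := by
      have := continuous_polarPoint
      fun_prop
    exact this
  rw [diskMeasure, ← integral_indicator measurableSet_ball, ← Complex.integral_comp_polarCoord_symm]
  have h1 : Set.EqOn (fun p : ℝ × ℝ => p.1 • (Metric.ball (0:ℂ) 1).indicator F
      (Complex.polarCoord.symm p)) ((Set.Ioo 0 1 ×ˢ Set.Ioo (-π) π).indicator
        (Function.uncurry fun r t => r * F (polarPoint r t))) polarCoord.target := by
    rintro ⟨r, t⟩ hp
    rw [polarCoord_target] at hp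
    have hr : 0 < r := hp.1
    have e : Complex.polarCoord.symm (r, t) = polarPoint r t := by
      rw [Complex.polarCoord_symm_apply, polarPoint]
    simp only [e]
    by_cases h : r < 1
    · rw [Set.indicator_of_mem, Set.indicator_of_mem]
      · rfl
      · exact ⟨⟨hr, h⟩, hp.2⟩
      · simpa [norm_polarPoint hr] using h
    · rw [Set.indicator_of_notMem, Set.indicator_of_notMem, smul_zero]
      · exact fun h' => h h'.1.2
      · simpa [norm_polarPoint hr] using h
  rw [setIntegral_congr_fun polarCoord.open_target.measurableSet h1,
    setIntegral_indicator (measurableSet_Ioo.prod measurableSet_Ioo)]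
  have h2 : polarCoord.target ∩ Set.Ioo (0:ℝ) 1 ×ˢ Set.Ioo (-π) π
      = Set.Ioo (0:ℝ) 1 ×ˢ Set.Ioo (-π) π := by
    rw [polarCoord_target, Set.inter_eq_right]
    exact Set.prod_mono (fun _ h => h.1) le_rfl
  rw [h2, Measure.volume_eq_prod, setIntegral_prod]
  · rw [← intervalIntegral_swap_of_continuous hc,
      intervalIntegral.integral_of_le zero_le_one, integral_Ioc_eq_integral_Ioo]
    congr 1
    ext r
    rw [intervalIntegral.integral_of_le (by linarith [Real.pi_pos]), integral_Ioc_eq_integral_Ioo]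
    rfl
  · rw [← Measure.volume_eq_prod]
    exact (hc.continuousOn.integrableOn_compact (isCompact_Icc.prod isCompact_Icc)).mono_set
      (Set.prod_mono Set.Ioo_subset_Icc_self Set.Ioo_subset_Icc_self)

theorem continuous_gradient {w : ℂ → ℝ} (h : ContDiff ℝ ∞ w) : Continuous (gradient w) := by
  unfold gradient
  have := h.continuous_fderiv (by simp)
  fun_prop

theorem fderiv_sq_le (w : ℂ → ℝ) (z v : ℂ) :
    fderiv ℝ w z v ^ 2 ≤ ‖v‖ ^ 2 * ‖gradient w z‖ ^ 2 := by
  rw [← inner_gradient_left, ← mul_pow, mul_comm ‖v‖, ← sq_abs]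
  gcongr
  exact abs_real_inner_le_norm _ _

/-- Trace and Poincaré inequality for smooth functions whose boundary values have mean zero. -/
theorem disk_poincare {w : ℂ → ℝ} (hw : ContDiff ℝ ∞ w) (hmean : ∫ θ, w (bdryPoint θ) = 0) :
    (∫ θ, w (bdryPoint θ) ^ 2) ≤ 500 * ∫ z, ‖gradient w z‖ ^ 2 ∂diskMeasure ∧
    (∫ z, w z ^ 2 ∂diskMeasure) ≤ 1500 * ∫ z, ‖gradient w z‖ ^ 2 ∂diskMeasure := by
  have cg := continuous_gradient hw
  have cw := hw.continuous
  have cp := continuous_polarPoint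
  have hd : ∀ z, HasFDerivAt w (fderiv ℝ w z) z := fun z =>
    (hw.differentiable (by simp) z).hasFDerivAt
  have cfd := hw.continuous_fderiv (by simp)
  rw [integral_disk_eq (F := fun z => ‖gradient w z‖ ^ 2) (by fun_prop),
    integral_disk_eq (F := fun z => w z ^ 2) (by fun_prop), integral_bdry_eq]
  simp only [bdryPoint_coe]
  have hpr : ∀ r t, HasDerivAt (fun s => polarPoint s t) (polarPoint 1 t) r := by
    intro r t
    have := (Complex.ofRealCLM.hasDerivAt (x := r)).mul_const
      ((Real.cos t : ℂ) + Real.sin t * Complex.I)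
    simpa [polarPoint] using this
  have hpt : ∀ r t, HasDerivAt (fun s => polarPoint r s)
      (r * ((-Real.sin t : ℝ) + Real.cos t * Complex.I)) t := by
    intro r t
    exact (((Real.hasDerivAt_cos t).ofReal_comp).add
      (((Real.hasDerivAt_sin t).ofReal_comp).mul_const Complex.I)).const_mul (r : ℂ)
  have n1 : ∀ t, ‖polarPoint 1 t‖ = 1 := norm_polarPoint one_pos
  have n2 : ∀ r t : ℝ, ‖(r : ℂ) * ((-Real.sin t : ℝ) + Real.cos t * Complex.I)‖ ^ 2 = r ^ 2 := by
    intro r t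
    rw [← Complex.normSq_eq_norm_sq, Complex.normSq_mul, Complex.normSq_add_mul_I,
      Complex.normSq_ofReal]
    nlinarith [Real.sin_sq_add_cos_sq t]
  refine polar_poincare (f := fun r t => w (polarPoint r t))
    (fr := fun r t => fderiv ℝ w (polarPoint r t) (polarPoint 1 t))
    (ft := fun r t => fderiv ℝ w (polarPoint r t)
      (r * ((-Real.sin t : ℝ) + Real.cos t * Complex.I)))
    (E := fun r t => ‖gradient w (polarPoint r t)‖ ^ 2)
    (fun r t => (hd _).comp_hasDerivAt r (hpr r t)) (fun r t => (hd _).comp_hasDerivAt t (hpt r t))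
    (cw.comp cp) ?_ ?_ ((cg.comp cp).norm.pow 2) ?_ ?_ ?_
  · have c1 : Continuous fun p : ℝ × ℝ => polarPoint 1 p.2 :=
      cp.comp (by fun_prop : Continuous fun p : ℝ × ℝ => ((1:ℝ), p.2))
    exact (cfd.comp cp).clm_apply c1
  · refine (cfd.comp cp).clm_apply ?_
    fun_prop
  · intro r t
    refine (fderiv_sq_le w _ _).trans ?_
    rw [n1]; simp
  · intro r t
    refine (fderiv_sq_le w _ _).trans ?_
    rw [n2]
  · rw [← hmean, integral_bdry_eq]
    simp only [bdryPoint_coe]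

/-! ### The Hilbert space of functions with gradient and trace -/

theorem memLp_disk {F : Type*} [NormedAddCommGroup F] [MeasurableSpace F] [BorelSpace F]
    [SecondCountableTopology F] {f : ℂ → F} (hf : Continuous f) : MemLp f 2 diskMeasure := by
  obtain ⟨C, hC⟩ := (isCompact_closedBall (0 : ℂ) 1).exists_bound_of_continuousOn hf.continuousOn
  refine MemLp.of_bound hf.aestronglyMeasurable C ?_
  filter_upwards [ae_restrict_mem measurableSet_ball] with z hz
  exact hC z (Metric.ball_subset_closedBall hz)

theorem memLp_bdry {f : Bdry → ℝ} (hf : Continuous f) : MemLp f 2 volume := by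
  obtain ⟨C, hC⟩ := isCompact_univ.exists_bound_of_continuousOn hf.continuousOn
  exact MemLp.of_bound hf.aestronglyMeasurable C (ae_of_all _ fun z => hC z trivial)

theorem norm_sq_eq_integral {α F : Type*} [MeasurableSpace α] {μ : Measure α}
    [NormedAddCommGroup F] [InnerProductSpace ℝ F] (f : Lp F 2 μ) :
    ‖f‖ ^ 2 = ∫ x, ‖f x‖ ^ 2 ∂μ := by
  rw [← real_inner_self_eq_norm_sq, L2.inner_def]
  simp_rw [real_inner_self_eq_norm_sq]

/-- Triples of a function on the disk, a vector field on the disk and a function on the boundary;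
a function of `H¹(Ω)` is recorded together with its gradient and its trace. -/
abbrev TripleSpace : Type := WithLp 2 (L2Disk × WithLp 2 (L2DiskVec × L2Bdry))

/-- The triple `(u, G, g)`. -/
def triple (u : L2Disk) (G : L2DiskVec) (g : L2Bdry) : TripleSpace :=
  WithLp.toLp 2 (u, WithLp.toLp 2 (G, g))

/-- The function component. -/
def funL : TripleSpace →L[ℝ] L2Disk := WithLp.fstL 2 ℝ _ _

/-- The gradient component. -/
def gradL : TripleSpace →L[ℝ] L2DiskVec :=
  (WithLp.fstL 2 ℝ L2DiskVec L2Bdry).comp (WithLp.sndL 2 ℝ L2Disk _)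

/-- The trace component. -/
def traceL : TripleSpace →L[ℝ] L2Bdry :=
  (WithLp.sndL 2 ℝ L2DiskVec L2Bdry).comp (WithLp.sndL 2 ℝ L2Disk _)

@[simp] theorem funL_triple (u : L2Disk) (G : L2DiskVec) (g : L2Bdry) :
    funL (triple u G g) = u := rfl
@[simp] theorem gradL_triple (u : L2Disk) (G : L2DiskVec) (g : L2Bdry) :
    gradL (triple u G g) = G := rfl
@[simp] theorem traceL_triple (u : L2Disk) (G : L2DiskVec) (g : L2Bdry) :
    traceL (triple u G g) = g := rfl

theorem norm_sq_tripleSpace (x : TripleSpace) :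
    ‖x‖ ^ 2 = ‖funL x‖ ^ 2 + (‖gradL x‖ ^ 2 + ‖traceL x‖ ^ 2) := by
  rw [WithLp.prod_norm_sq_eq_of_L2, WithLp.prod_norm_sq_eq_of_L2]
  rfl

theorem memLp_trace {w : ℂ → ℝ} (hw : ContDiff ℝ ∞ w) :
    MemLp (fun θ => w (bdryPoint θ)) 2 (volume : Measure Bdry) :=
  memLp_bdry (hw.continuous.comp continuous_bdryPoint)

/-- The triple of a function that is smooth up to the boundary. -/
def smoothTriple (w : ℂ → ℝ) (hw : ContDiff ℝ ∞ w) : TripleSpace :=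
  triple ((memLp_disk hw.continuous).toLp w) ((memLp_disk (continuous_gradient hw)).toLp _)
    ((memLp_trace hw).toLp _)

theorem gradient_add_of_contDiff {v w : ℂ → ℝ} (hv : ContDiff ℝ ∞ v) (hw : ContDiff ℝ ∞ w) :
    gradient (v + w) = gradient v + gradient w := by
  ext1 z
  simp only [gradient, Pi.add_apply, ← map_add]
  rw [fderiv_add (hv.differentiable (by simp) z) (hw.differentiable (by simp) z)]

theorem gradient_smul_of_contDiff (c : ℝ) {w : ℂ → ℝ} (hw : ContDiff ℝ ∞ w) :
    gradient (c • w) = c • gradient w := by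
  ext1 z
  simp only [gradient, Pi.smul_apply]
  rw [fderiv_const_smul (hw.differentiable (by simp) z), map_smulₛₗ]
  rfl

/-- The triples of functions that are smooth up to the boundary. -/
def smoothTriples : Submodule ℝ TripleSpace where
  carrier := {x | ∃ w, ∃ hw : ContDiff ℝ ∞ w, smoothTriple w hw = x}
  add_mem' := by
    rintro _ _ ⟨v, hv, rfl⟩ ⟨w, hw, rfl⟩
    refine ⟨v + w, hv.add hw, ?_⟩
    simp only [smoothTriple, gradient_add_of_contDiff hv hw]
    rfl
  zero_mem' := by
    refine ⟨0, contDiff_const, ?_⟩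
    have h : gradient (0 : ℂ → ℝ) = 0 := gradient_const' 0
    simp only [smoothTriple, h]
    rfl
  smul_mem' := by
    rintro c _ ⟨w, hw, rfl⟩
    refine ⟨c • w, contDiff_const.smul hw, ?_⟩
    simp only [smoothTriple, gradient_smul_of_contDiff c hw]
    rfl

/-- The closed space of triples `(u, ∇u, u|_∂Ω)` with `u ∈ H¹(Ω)`, as the closure of the smooth
ones. -/
def traceSpace : Submodule ℝ TripleSpace := smoothTriples.topologicalClosure

theorem tendsto_tripleSpace_iff {x : ℕ → TripleSpace} {y : TripleSpace} :
    Tendsto x atTop (𝓝 y) ↔ Tendsto (fun k => funL (x k)) atTop (𝓝 (funL y)) ∧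
      Tendsto (fun k => gradL (x k)) atTop (𝓝 (gradL y)) ∧
      Tendsto (fun k => traceL (x k)) atTop (𝓝 (traceL y)) := by
  constructor
  · exact fun h => ⟨(funL.continuous.tendsto y).comp h, (gradL.continuous.tendsto y).comp h,
      (traceL.continuous.tendsto y).comp h⟩
  · rintro ⟨h1, h2, h3⟩
    have h4 := (((WithLp.prodContinuousLinearEquiv 2 ℝ L2DiskVec L2Bdry).symm.continuous.tendsto _)).comp
      (h2.prodMk_nhds h3)
    exact (((WithLp.prodContinuousLinearEquiv 2 ℝ L2Disk
      (WithLp 2 (L2DiskVec × L2Bdry))).symm.continuous.tendsto _)).comp (h1.prodMk_nhds h4)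

theorem tendsto_toLp_iff {α F : Type*} [MeasurableSpace α] {μ : Measure α} [NormedAddCommGroup F]
    {f : ℕ → α → F} (hf : ∀ k, MemLp (f k) 2 μ) (g : Lp F 2 μ) :
    Tendsto (fun k => (hf k).toLp (f k)) atTop (𝓝 g) ↔
      Tendsto (fun k => eLpNorm (fun x => f k x - g x) 2 μ) atTop (𝓝 0) := by
  have := Lp.tendsto_Lp_iff_tendsto_eLpNorm'' (fi := atTop) f hf g (Lp.memLp g)
  rw [Lp.toLp_coeFn] at this
  exact this

/-- The triples described by `HasTrace` are the limits of the smooth ones. -/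
theorem hasTrace_iff {u : L2Disk} {G : L2DiskVec} {g : L2Bdry} :
    HasTrace u G g ↔ triple u G g ∈ traceSpace := by
  rw [traceSpace, ← SetLike.mem_coe, Submodule.topologicalClosure_coe, mem_closure_iff_seq_limit]
  constructor
  · rintro ⟨w, hw, h1, h2, h3⟩
    exact ⟨fun k => smoothTriple (w k) (hw k), fun k => ⟨w k, hw k, rfl⟩,
      tendsto_tripleSpace_iff.2 ⟨(tendsto_toLp_iff (fun k => memLp_disk (hw k).continuous) _).2 h1,
        (tendsto_toLp_iff (fun k => memLp_disk (continuous_gradient (hw k))) _).2 h2,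
        (tendsto_toLp_iff (fun k => memLp_trace (hw k)) _).2 h3⟩⟩
  · rintro ⟨x, hx, hlim⟩
    choose w hw hwx using hx
    obtain rfl : (fun k => smoothTriple (w k) (hw k)) = x := funext hwx
    obtain ⟨h1, h2, h3⟩ := tendsto_tripleSpace_iff.1 hlim
    exact ⟨w, hw, (tendsto_toLp_iff (fun k => memLp_disk (hw k).continuous) _).1 h1,
      (tendsto_toLp_iff (fun k => memLp_disk (continuous_gradient (hw k))) _).1 h2,
      (tendsto_toLp_iff (fun k => memLp_trace (hw k)) _).1 h3⟩

/-- The triple of the constant function `1`. -/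
def oneTriple : TripleSpace := smoothTriple (fun _ => 1) contDiff_const

theorem oneTriple_mem : oneTriple ∈ traceSpace :=
  Submodule.le_topologicalClosure _ ⟨_, _, rfl⟩

theorem gradL_oneTriple : gradL oneTriple = 0 := by
  have h : gradient (fun _ : ℂ => (1 : ℝ)) = 0 := gradient_const' 1
  simp only [oneTriple, smoothTriple, gradL_triple, h]
  rfl

theorem coeFn_traceL_oneTriple : (traceL oneTriple : Bdry → ℝ) =ᵐ[volume] fun _ => 1 :=
  MemLp.coeFn_toLp (memLp_trace contDiff_const)

theorem inner_traceL_oneTriple (g : L2Bdry) : inner ℝ g (traceL oneTriple) = ∫ θ, g θ := by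
  rw [L2.inner_def]
  refine integral_congr_ae ?_
  filter_upwards [coeFn_traceL_oneTriple] with θ hθ
  rw [hθ]
  simp

/-- The mean value over the boundary. -/
def meanL : L2Bdry →L[ℝ] ℝ := (2 * π)⁻¹ • innerSL ℝ (traceL oneTriple)

theorem meanL_apply (g : L2Bdry) : meanL g = (2 * π)⁻¹ * ∫ θ, g θ := by
  rw [← inner_traceL_oneTriple, real_inner_comm]
  rfl

theorem meanFree_iff {g : L2Bdry} : MeanFree g ↔ meanL g = 0 := by
  have := Real.pi_pos
  rw [meanL_apply, MeanFree]
  simp [this.ne']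

theorem meanL_one : meanL (traceL oneTriple) = 1 := by
  have := Real.pi_pos
  rw [meanL_apply, integral_congr_ae coeFn_traceL_oneTriple, integral_const, Measure.real, AddCircle.measure_univ,
    ENNReal.toReal_ofReal (by positivity)]
  simp
  field_simp

/-- The triple of `u` minus the boundary mean of `u`. -/
def centerL : TripleSpace →L[ℝ] TripleSpace :=
  ContinuousLinearMap.id ℝ _ - (meanL.comp traceL).smulRight oneTriple

theorem centerL_apply (x : TripleSpace) : centerL x = x - meanL (traceL x) • oneTriple := rfl

theorem gradL_centerL (x : TripleSpace) : gradL (centerL x) = gradL x := by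
  rw [centerL_apply, map_sub, map_smul, gradL_oneTriple, smul_zero, sub_zero]

theorem meanL_centerL (x : TripleSpace) : meanL (traceL (centerL x)) = 0 := by
  rw [centerL_apply, map_sub, map_sub, map_smul, map_smul, meanL_one, smul_eq_mul, mul_one,
    sub_self]

theorem centerL_mem {x : TripleSpace} (hx : x ∈ traceSpace) : centerL x ∈ traceSpace :=
  sub_mem hx (Submodule.smul_mem _ _ oneTriple_mem)

theorem centerL_mem_smooth {x : TripleSpace} (hx : x ∈ smoothTriples) :
    centerL x ∈ smoothTriples :=
  sub_mem hx (Submodule.smul_mem _ _ ⟨_, _, rfl⟩)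

theorem norm_sq_toLp {α F : Type*} [MeasurableSpace α] {μ : Measure α}
    [NormedAddCommGroup F] [InnerProductSpace ℝ F] {f : α → F} (hf : MemLp f 2 μ) :
    ‖hf.toLp f‖ ^ 2 = ∫ x, ‖f x‖ ^ 2 ∂μ := by
  rw [norm_sq_eq_integral]
  refine integral_congr_ae ?_
  filter_upwards [hf.coeFn_toLp] with x hx
  rw [hx]

/-- Trace and Poincaré inequality: after subtraction of the boundary mean, function and trace are
controlled by the gradient. Both sides are continuous, so the smooth case suffices. -/
theorem norm_sq_centerL_le {x : TripleSpace} (hx : x ∈ traceSpace) :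
    ‖centerL x‖ ^ 2 ≤ 2001 * ‖gradL x‖ ^ 2 := by
  have hcl : IsClosed {x : TripleSpace | ‖centerL x‖ ^ 2 ≤ 2001 * ‖gradL x‖ ^ 2} :=
    isClosed_le (by fun_prop) (by fun_prop)
  refine closure_minimal ?_ hcl hx
  intro y hy
  obtain ⟨w, hw, he⟩ := centerL_mem_smooth hy
  have hm : ∫ θ, w (bdryPoint θ) = 0 := by
    have h1 := meanFree_iff.2 (meanL_centerL y)
    rw [← he] at h1
    rw [← h1]
    refine integral_congr_ae ?_
    exact (MemLp.coeFn_toLp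
      (memLp_trace hw)).symm
  obtain ⟨h1, h2⟩ := disk_poincare hw hm
  have e1 : ‖funL (centerL y)‖ ^ 2 = ∫ z, w z ^ 2 ∂diskMeasure := by
    rw [← he]
    refine (norm_sq_toLp (memLp_disk hw.continuous)).trans ?_
    simp_rw [Real.norm_eq_abs, sq_abs]
  have e2 : ‖gradL y‖ ^ 2 = ∫ z, ‖gradient w z‖ ^ 2 ∂diskMeasure := by
    rw [← gradL_centerL, ← he]
    exact norm_sq_toLp (memLp_disk (continuous_gradient hw))
  have e3 : ‖traceL (centerL y)‖ ^ 2 = ∫ θ, w (bdryPoint θ) ^ 2 := by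
    rw [← he]
    refine (norm_sq_toLp (memLp_trace hw)).trans ?_
    simp_rw [Real.norm_eq_abs, sq_abs]
  rw [← e2] at h1 h2
  rw [← e1] at h2
  rw [← e3] at h1
  change ‖centerL y‖ ^ 2 ≤ _
  rw [norm_sq_tripleSpace, gradL_centerL]
  linarith

/-! ### Integration by parts -/

theorem integral_mul_fderiv_disk_eq_neg {w η : ℂ → ℝ} (hw : ContDiff ℝ ∞ w) (hη : ContDiff ℝ ∞ η)
    (hc : HasCompactSupport η) (hs : tsupport η ⊆ Metric.ball (0 : ℂ) 1) (v : ℂ) :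
    ∫ z, w z * fderiv ℝ η z v ∂diskMeasure = -∫ z, fderiv ℝ w z v * η z ∂diskMeasure := by
  have h0 : ∀ z ∉ Metric.ball (0 : ℂ) 1, η z = 0 := fun z hz =>
    image_eq_zero_of_notMem_tsupport fun h => hz (hs h)
  have h1 : ∀ z ∉ Metric.ball (0 : ℂ) 1, fderiv ℝ η z = 0 := fun z hz =>
    fderiv_of_notMem_tsupport ℝ fun h => hz (hs h)
  have cw := hw.continuous_fderiv (by simp)
  have cη := hη.continuous_fderiv (by simp)
  have c0 := hw.continuous
  have c1 := hη.continuous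
  rw [setIntegral_eq_integral_of_forall_compl_eq_zero, setIntegral_eq_integral_of_forall_compl_eq_zero]
  · refine integral_mul_fderiv_eq_neg_fderiv_mul_of_integrable ?_ ?_ ?_
      (fun x _ => hw.differentiable (by simp) x) (fun x _ => hη.differentiable (by simp) x)
    · exact Continuous.integrable_of_hasCompactSupport (by fun_prop) hc.mul_left
    · refine Continuous.integrable_of_hasCompactSupport (by fun_prop) (HasCompactSupport.mul_left ?_)
      exact hc.fderiv_apply (𝕜 := ℝ) v
    · exact Continuous.integrable_of_hasCompactSupport (by fun_prop) hc.mul_left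
  · intro z hz; rw [h0 z hz, mul_zero]
  · intro z hz; rw [h1 z hz]; simp

/-- The weak gradient equation, tested against a fixed vector, is a closed condition on the triple, so
it passes from smooth functions to their limits. -/
theorem HasTrace.hasWeakGradient {u : L2Disk} {G : L2DiskVec} {g : L2Bdry} (h : HasTrace u G g) :
    HasWeakGradient u G := by
  intro η hη hc hs
  have cη := hη.continuous_fderiv (by simp)
  have c1 := hη.continuous
  have hx := hasTrace_iff.1 h
  have mη := memLp_disk c1
  have mg := memLp_disk (continuous_gradient hη)
  refine ext_inner_right ℝ fun v => ?_
  have ma : MemLp (fun z => fderiv ℝ η z v) 2 diskMeasure := memLp_disk (by fun_prop)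
  have mb : MemLp (fun z => η z • v) 2 diskMeasure := memLp_disk (by fun_prop)
  have hcl : IsClosed {x : TripleSpace |
      inner ℝ (funL x) (ma.toLp _) = -inner ℝ (gradL x) (mb.toLp _)} :=
    isClosed_eq (by fun_prop) (by fun_prop)
  have hmem := closure_minimal (s := (smoothTriples : Set TripleSpace)) ?_ hcl hx
  · have e : inner ℝ u (ma.toLp _) = -inner ℝ G (mb.toLp _) := hmem
    have i1 : Integrable (fun z => u z • gradient η z) diskMeasure :=
      memLp_one_iff_integrable.1 (mg.smul (Lp.memLp u))
    have i2 : Integrable (fun z => η z • G z) diskMeasure :=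
      memLp_one_iff_integrable.1 ((Lp.memLp G).smul mη)
    rw [inner_neg_left, real_inner_comm, ← integral_inner i1, real_inner_comm, ← integral_inner i2]
    rw [L2.inner_def, L2.inner_def] at e
    convert e using 1
    · refine integral_congr_ae ?_
      filter_upwards [ma.coeFn_toLp] with z hz
      rw [hz, inner_smul_right, real_inner_comm, inner_gradient_left]
      simp [mul_comm]
    · congr 1
      refine integral_congr_ae ?_
      filter_upwards [mb.coeFn_toLp] with z hz
      rw [hz, inner_smul_right, inner_smul_right, real_inner_comm]
  · rintro _ ⟨w, hw, rfl⟩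
    change inner ℝ ((memLp_disk hw.continuous).toLp w) (ma.toLp _)
      = -inner ℝ ((memLp_disk (continuous_gradient hw)).toLp _) (mb.toLp _)
    rw [L2.inner_def, L2.inner_def]
    convert integral_mul_fderiv_disk_eq_neg hw hη hc hs v using 1
    · refine integral_congr_ae ?_
      filter_upwards [ma.coeFn_toLp, (memLp_disk hw.continuous).coeFn_toLp] with z hz hz'
      rw [hz, hz']
      simp [mul_comm]
    · congr 1
      refine integral_congr_ae ?_
      filter_upwards [mb.coeFn_toLp, (memLp_disk (continuous_gradient hw)).coeFn_toLp] with z hz hz'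
      rw [hz, hz', inner_smul_right, inner_gradient_left, mul_comm]

/-! ### The energy form -/

theorem IsConductivity.ae_abs_le {σ : ℂ → ℝ} (hσ : IsConductivity σ) :
    ∃ C : ℝ, ∀ᵐ z ∂diskMeasure, ‖σ z‖ ≤ C := by
  obtain ⟨C, hC⟩ := hσ.bounded
  obtain ⟨c, hc, hc'⟩ := hσ.positive
  refine ⟨C, ?_⟩
  filter_upwards [hC, hc'] with z h1 h2
  rw [Real.norm_eq_abs, abs_of_pos (hc.trans_le h2)]
  exact h1

theorem isConductivity_one : IsConductivity fun _ => 1 :=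
  ⟨aemeasurable_const, ⟨1, ae_of_all _ fun _ => le_rfl⟩,
    ⟨1, one_pos, ae_of_all _ fun _ => le_rfl⟩⟩

/-- The energy form `(G, F) ↦ ∫_Ω σ G · F`. -/
def energy (σ : ℂ → ℝ) (G F : L2DiskVec) : ℝ := ∫ z, σ z * inner ℝ (G z) (F z) ∂diskMeasure

section Energy

variable {σ : ℂ → ℝ}

theorem energy_comm (σ : ℂ → ℝ) (G F : L2DiskVec) : energy σ G F = energy σ F G := by
  simp only [energy, real_inner_comm]

theorem integrable_energy (hσ : IsConductivity σ) (G F : L2DiskVec) :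
    Integrable (fun z => σ z * inner ℝ (G z) (F z)) diskMeasure := by
  obtain ⟨C, hC⟩ := hσ.ae_abs_le
  exact (L2.integrable_inner G F).bdd_mul hσ.aemeasurable.aestronglyMeasurable hC

theorem energy_add_left (hσ : IsConductivity σ) (G G' F : L2DiskVec) :
    energy σ (G + G') F = energy σ G F + energy σ G' F := by
  rw [energy, energy, energy, ← integral_add (integrable_energy hσ _ _) (integrable_energy hσ _ _)]
  refine integral_congr_ae ?_
  filter_upwards [Lp.coeFn_add G G'] with z hz
  rw [hz, Pi.add_apply, inner_add_left, mul_add]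

theorem energy_smul_left (c : ℝ) (G F : L2DiskVec) :
    energy σ (c • G) F = c * energy σ G F := by
  rw [energy, energy, ← integral_const_mul]
  refine integral_congr_ae ?_
  filter_upwards [Lp.coeFn_smul c G] with z hz
  rw [hz, Pi.smul_apply, inner_smul_left]
  simp only [conj_trivial]
  ring

theorem exists_abs_energy_le (hσ : IsConductivity σ) :
    ∃ C : ℝ, ∀ G F : L2DiskVec, ‖energy σ G F‖ ≤ C * ‖G‖ * ‖F‖ := by
  obtain ⟨C, hC⟩ := hσ.ae_abs_le
  refine ⟨max C 0, fun G F => ?_⟩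
  have hm : MemLp (fun z => σ z • G z) 2 diskMeasure := by
    refine MemLp.of_le_mul (Lp.memLp G)
      (hσ.aemeasurable.aestronglyMeasurable.smul (Lp.aestronglyMeasurable G)) (c := max C 0) ?_
    filter_upwards [hC] with z hz
    rw [norm_smul]
    gcongr
    exact hz.trans (le_max_left _ _)
  have h1 : energy σ G F = inner ℝ (hm.toLp _) F := by
    rw [L2.inner_def, energy]
    refine integral_congr_ae ?_
    filter_upwards [hm.coeFn_toLp] with z hz
    rw [hz, inner_smul_left]
    simp
  have h2 : ‖hm.toLp _‖ ≤ max C 0 * ‖G‖ := by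
    refine Lp.norm_le_mul_norm_of_ae_le_mul ?_
    filter_upwards [hm.coeFn_toLp, hC] with z hz hz'
    rw [hz, norm_smul]
    gcongr
    exact hz'.trans (le_max_left _ _)
  rw [h1]
  exact (norm_inner_le_norm _ _).trans (by gcongr)

/-- The energy form as a continuous bilinear form. -/
def energyL (hσ : IsConductivity σ) : L2DiskVec →L[ℝ] L2DiskVec →L[ℝ] ℝ :=
  LinearMap.mkContinuous₂ (LinearMap.mk₂ ℝ (energy σ) (energy_add_left hσ) energy_smul_left
    (fun G F F' => by rw [energy_comm, energy_add_left hσ, energy_comm σ F, energy_comm σ F'])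
    (fun c G F => by rw [energy_comm, energy_smul_left, energy_comm σ F]; rfl))
    (exists_abs_energy_le hσ).choose (exists_abs_energy_le hσ).choose_spec

theorem energyL_apply (hσ : IsConductivity σ) (G F : L2DiskVec) :
    energyL hσ G F = energy σ G F := rfl

theorem exists_le_energy (hσ : IsConductivity σ) :
    ∃ c : ℝ, 0 < c ∧ ∀ G : L2DiskVec, c * ‖G‖ ^ 2 ≤ energy σ G G := by
  obtain ⟨c, hc, hc'⟩ := hσ.positive
  refine ⟨c, hc, fun G => ?_⟩
  rw [← real_inner_self_eq_norm_sq, L2.inner_def, ← integral_const_mul]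
  refine integral_mono_ae ((L2.integrable_inner G G).const_mul c) (integrable_energy hσ G G) ?_
  filter_upwards [hc'] with z hz
  exact mul_le_mul_of_nonneg_right hz real_inner_self_nonneg

/-! ### Existence and uniqueness of voltages -/

/-- Since every element of the trace space has its second component as weak gradient, the variational
problem lives on the trace space alone. -/
theorem isVoltage_iff {ψ g : L2Bdry} : IsVoltage σ ψ g ↔ MeanFree g ∧
    ∃ x ∈ traceSpace, traceL x = g ∧
      ∀ y ∈ traceSpace, energy σ (gradL x) (gradL y) = inner ℝ ψ (traceL y) := by
  have hin : ∀ h : L2Bdry, inner ℝ ψ h = ∫ θ, ψ θ * h θ := by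
    intro h
    rw [L2.inner_def]
    refine integral_congr_ae (ae_of_all _ fun θ => ?_)
    simp [mul_comm]
  refine and_congr_right fun _ => ?_
  constructor
  · rintro ⟨u, G, ⟨-, h2⟩, h3⟩
    refine ⟨triple u G g, hasTrace_iff.1 h3, rfl, fun y hy => ?_⟩
    have hy' : HasTrace (funL y) (gradL y) (traceL y) := hasTrace_iff.2 hy
    rw [hin]
    exact h2 _ _ _ hy'.hasWeakGradient hy'
  · rintro ⟨x, hx, rfl, h⟩
    have hx' : HasTrace (funL x) (gradL x) (traceL x) := hasTrace_iff.2 hx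
    refine ⟨funL x, gradL x, ⟨hx'.hasWeakGradient, fun v F h' _ hv => ?_⟩, hx'⟩
    rw [← hin]
    exact h (triple v F h') (hasTrace_iff.1 hv)

/-- The elements of the trace space whose boundary values have mean zero. -/
def meanFreeSpace : Submodule ℝ TripleSpace :=
  traceSpace ⊓ LinearMap.ker (meanL.comp traceL).toLinearMap

theorem mem_meanFreeSpace {x : TripleSpace} :
    x ∈ meanFreeSpace ↔ x ∈ traceSpace ∧ meanL (traceL x) = 0 := Iff.rfl

theorem isClosed_meanFreeSpace : IsClosed (meanFreeSpace : Set TripleSpace) :=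
  (Submodule.isClosed_topologicalClosure _).inter (meanL.comp traceL).isClosed_ker

theorem norm_sq_le_of_mem_meanFreeSpace {x : TripleSpace} (hx : x ∈ meanFreeSpace) :
    ‖x‖ ^ 2 ≤ 2001 * ‖gradL x‖ ^ 2 := by
  have h := norm_sq_centerL_le hx.1
  rwa [centerL_apply, (mem_meanFreeSpace.1 hx).2, zero_smul, sub_zero] at h

/-- The Lax–Milgram theorem on a closed subspace. -/
theorem exists_forall_mem_eq_of_coercive {H : Type*} [NormedAddCommGroup H]
    [InnerProductSpace ℝ H] [CompleteSpace H] {K : Submodule ℝ H} (hK : IsClosed (K : Set H))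
    (B : H →L[ℝ] H →L[ℝ] ℝ) {c : ℝ} (hc : 0 < c) (hB : ∀ x ∈ K, c * ‖x‖ ^ 2 ≤ B x x)
    (ℓ : H →L[ℝ] ℝ) : ∃ x ∈ K, ∀ y ∈ K, B x y = ℓ y := by
  have : CompleteSpace K := hK.completeSpace_coe
  have hco : IsCoercive (B.bilinearComp K.subtypeL K.subtypeL) := by
    refine ⟨c, hc, fun x => ?_⟩
    have := hB x x.2
    rwa [sq, ← mul_assoc] at this
  set T := hco.continuousLinearEquivOfBilin with hT
  obtain ⟨x, hx⟩ := T.surjective ((InnerProductSpace.toDual ℝ K).symm (ℓ.comp K.subtypeL))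
  refine ⟨x, x.2, fun y hy => ?_⟩
  have h := hco.continuousLinearEquivOfBilin_apply x ⟨y, hy⟩
  rw [← hT, hx, InnerProductSpace.toDual_symm_apply] at h
  exact h.symm

/-- Lax–Milgram gives the variational equation for mean free test functions; as `ψ` is mean free, both
sides are unchanged when a constant is added to the test function. -/
theorem exists_isVoltage (hσ : IsConductivity σ) {ψ : L2Bdry} (hψ : MeanFree ψ) :
    ∃ g, IsVoltage σ ψ g := by
  obtain ⟨c, hc, hcE⟩ := exists_le_energy hσ
  obtain ⟨x, hx, key⟩ := exists_forall_mem_eq_of_coercive isClosed_meanFreeSpace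
    ((energyL hσ).bilinearComp gradL gradL) (c := c / 2001) (by positivity)
    (fun x hx => by
      have h1 := norm_sq_le_of_mem_meanFreeSpace hx
      calc c / 2001 * ‖x‖ ^ 2 ≤ c / 2001 * (2001 * ‖gradL x‖ ^ 2) := by gcongr
        _ = c * ‖gradL x‖ ^ 2 := by ring
        _ ≤ _ := hcE (gradL x))
    ((innerSL ℝ ψ).comp traceL)
  have key' : ∀ y ∈ meanFreeSpace, energy σ (gradL x) (gradL y) = inner ℝ ψ (traceL y) := key
  refine ⟨traceL x, isVoltage_iff.2 ⟨meanFree_iff.2 (mem_meanFreeSpace.1 hx).2, x, hx.1, rfl,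
    fun y hy => ?_⟩⟩
  have h1 := key' (centerL y) ⟨centerL_mem hy, meanL_centerL y⟩
  rw [gradL_centerL] at h1
  rw [h1, centerL_apply, map_sub, map_smul, inner_sub_right, inner_smul_right,
    inner_traceL_oneTriple, hψ, mul_zero, sub_zero]

theorem IsVoltage.unique (hσ : IsConductivity σ) {ψ g g' : L2Bdry} (h : IsVoltage σ ψ g)
    (h' : IsVoltage σ ψ g') : g = g' := by
  obtain ⟨hm, x, hx, rfl, he⟩ := isVoltage_iff.1 h
  obtain ⟨hm', x', hx', rfl, he'⟩ := isVoltage_iff.1 h'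
  obtain ⟨c, hc, hcE⟩ := exists_le_energy hσ
  have hmem : x - x' ∈ meanFreeSpace := mem_meanFreeSpace.2 ⟨sub_mem hx hx', by
    rw [map_sub, map_sub, meanFree_iff.1 hm, meanFree_iff.1 hm', sub_zero]⟩
  have h0 : energy σ (gradL (x - x')) (gradL (x - x')) = 0 := by
    have e1 := he _ hmem.1
    have e2 := he' _ hmem.1
    rw [← energyL_apply hσ] at e1 e2 ⊢
    conv_lhs => rw [map_sub gradL x x', map_sub (energyL hσ), ← map_sub gradL x x']
    rw [sub_apply, e1, e2, sub_self]
  have h1 := hcE (gradL (x - x'))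
  rw [h0] at h1
  have h2 : ‖gradL (x - x')‖ ^ 2 ≤ 0 := by
    by_contra h; push Not at h
    nlinarith
  have h3 := norm_sq_le_of_mem_meanFreeSpace hmem
  have h4 : ‖x - x'‖ ^ 2 ≤ 0 := by linarith
  have h5 : x - x' = 0 := by
    rw [← norm_eq_zero]
    exact pow_eq_zero_iff two_ne_zero |>.1 (le_antisymm h4 (sq_nonneg _))
  rw [sub_eq_zero.1 h5]

theorem isVoltage_ndMap (hσ : IsConductivity σ) {ψ : L2Bdry} (hψ : MeanFree ψ) :
    IsVoltage σ ψ (ndMap σ ψ) := by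
  have h := exists_isVoltage hσ hψ
  rw [ndMap, dif_pos h]
  exact h.choose_spec

theorem IsVoltage.ndMap_eq (hσ : IsConductivity σ) {ψ g : L2Bdry} (h : IsVoltage σ ψ g) :
    ndMap σ ψ = g := by
  have h' : ∃ g, IsVoltage σ ψ g := ⟨g, h⟩
  rw [ndMap, dif_pos h']
  exact h'.choose_spec.unique hσ h

theorem existsUnique_isVoltage (hσ : IsConductivity σ) {ψ : L2Bdry} (hψ : MeanFree ψ) :
    ∃! g, IsVoltage σ ψ g :=
  ⟨ndMap σ ψ, isVoltage_ndMap hσ hψ, fun _ h => (h.ndMap_eq hσ).symm⟩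

theorem MeanFree.add {f g : L2Bdry} (hf : MeanFree f) (hg : MeanFree g) : MeanFree (f + g) := by
  rw [meanFree_iff] at *
  rw [map_add, hf, hg, add_zero]

theorem MeanFree.smul (c : ℝ) {f : L2Bdry} (hf : MeanFree f) : MeanFree (c • f) := by
  rw [meanFree_iff] at *
  rw [map_smul, hf, smul_zero]

theorem IsVoltage.add (hσ : IsConductivity σ) {ψ ψ' g g' : L2Bdry} (h : IsVoltage σ ψ g)
    (h' : IsVoltage σ ψ' g') : IsVoltage σ (ψ + ψ') (g + g') := by
  obtain ⟨hm, x, hx, rfl, he⟩ := isVoltage_iff.1 h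
  obtain ⟨hm', x', hx', rfl, he'⟩ := isVoltage_iff.1 h'
  refine isVoltage_iff.2 ⟨hm.add hm', x + x', add_mem hx hx', map_add _ _ _, fun y hy => ?_⟩
  rw [map_add, energy_add_left hσ, he y hy, he' y hy, inner_add_left]

theorem IsVoltage.smul (c : ℝ) {ψ g : L2Bdry} (h : IsVoltage σ ψ g) :
    IsVoltage σ (c • ψ) (c • g) := by
  obtain ⟨hm, x, hx, rfl, he⟩ := isVoltage_iff.1 h
  refine isVoltage_iff.2 ⟨hm.smul c, c • x, Submodule.smul_mem _ _ hx, map_smul _ _ _,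
    fun y hy => ?_⟩
  rw [map_smul, energy_smul_left, he y hy, inner_smul_left]
  simp

/-- The Neumann-to-Dirichlet map is symmetric. -/
theorem IsVoltage.inner_comm {ψ ψ' g g' : L2Bdry} (h : IsVoltage σ ψ g)
    (h' : IsVoltage σ ψ' g') : inner ℝ ψ g' = inner ℝ ψ' g := by
  obtain ⟨-, x, hx, rfl, he⟩ := isVoltage_iff.1 h
  obtain ⟨-, x', hx', rfl, he'⟩ := isVoltage_iff.1 h'
  rw [← he x' hx', ← he' x hx, energy_comm]

end Energy

/-! ### Rotations -/

/-- The rotation of the plane by the angle `α`. -/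
def planeRot (α : Bdry) : ℂ ≃ₗᵢ[ℝ] ℂ := rotation (AddCircle.toCircle α)

theorem planeRot_symm (α : Bdry) : (planeRot α).symm = planeRot (-α) := by
  rw [planeRot, planeRot, rotation_symm, AddCircle.toCircle_neg]

theorem planeRot_bdryPoint (α θ : Bdry) : planeRot α (bdryPoint θ) = bdryPoint (θ + α) := by
  simp only [planeRot, bdryPoint, rotation_apply, AddCircle.toCircle_add, Circle.coe_mul]
  ring

theorem measurePreserving_planeRot (α : Bdry) :
    MeasurePreserving (planeRot α) diskMeasure diskMeasure := by
  have h := (planeRot α).measurePreserving.restrict_preimage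
    (measurableSet_ball (x := (0 : ℂ)) (ε := 1))
  have e : planeRot α ⁻¹' Metric.ball (0 : ℂ) 1 = Metric.ball (0 : ℂ) 1 := by
    ext z
    simp
  rwa [e] at h

theorem measurePreserving_shift (α : Bdry) :
    MeasurePreserving (fun θ : Bdry => θ + α) volume volume :=
  measurePreserving_add_right volume α

/-- Translation by `α` of functions on the boundary. -/
def shift (α : Bdry) : L2Bdry →ₗᵢ[ℝ] L2Bdry :=
  Lp.compMeasurePreservingₗᵢ ℝ _ (measurePreserving_shift α)

theorem coeFn_shift (α : Bdry) (g : L2Bdry) : shift α g =ᵐ[volume] fun θ => g (θ + α) :=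
  Lp.coeFn_compMeasurePreserving g (measurePreserving_shift α)

/-- The function `z ↦ u (ρ z)`, where `ρ` is the rotation by `α`. -/
def rotFun (α : Bdry) : L2Disk →L[ℝ] L2Disk :=
  (Lp.compMeasurePreservingₗᵢ ℝ _ (measurePreserving_planeRot α)).toContinuousLinearMap

/-- The vector field `z ↦ ρ⁻¹ (G (ρ z))`, where `ρ` is the rotation by `α`. -/
def rotField (α : Bdry) : L2DiskVec →L[ℝ] L2DiskVec :=
  (ContinuousLinearMap.compLpL 2 diskMeasure
    ((planeRot α).symm.toContinuousLinearEquiv : ℂ →L[ℝ] ℂ)).comp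
  (Lp.compMeasurePreservingₗᵢ ℝ _ (measurePreserving_planeRot α)).toContinuousLinearMap

theorem coeFn_rotFun (α : Bdry) (u : L2Disk) :
    rotFun α u =ᵐ[diskMeasure] fun z => u (planeRot α z) :=
  Lp.coeFn_compMeasurePreserving u (measurePreserving_planeRot α)

theorem coeFn_rotField (α : Bdry) (G : L2DiskVec) :
    rotField α G =ᵐ[diskMeasure] fun z => (planeRot α).symm (G (planeRot α z)) := by
  refine (ContinuousLinearMap.coeFn_compLpL _ _).trans ?_
  filter_upwards [Lp.coeFn_compMeasurePreserving G (measurePreserving_planeRot α)] with z hz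
  exact congrArg (planeRot α).symm hz

/-- The rotation of a triple, compatible with gradients and traces. -/
def rotTriple (α : Bdry) (x : TripleSpace) : TripleSpace :=
  triple (rotFun α (funL x)) (rotField α (gradL x)) (shift α (traceL x))

theorem continuous_rotTriple (α : Bdry) : Continuous (rotTriple α) := by
  rw [continuous_iff_seqContinuous]
  intro x y h
  obtain ⟨h1, h2, h3⟩ := tendsto_tripleSpace_iff.1 h
  exact tendsto_tripleSpace_iff.2 ⟨((rotFun α).continuous.tendsto _).comp h1,
    ((rotField α).continuous.tendsto _).comp h2, ((shift α).continuous.tendsto _).comp h3⟩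

theorem gradient_comp_planeRot (α : Bdry) {w : ℂ → ℝ} (hw : ContDiff ℝ ∞ w) (z : ℂ) :
    gradient (fun z => w (planeRot α z)) z = (planeRot α).symm (gradient w (planeRot α z)) := by
  refine ext_inner_right ℝ fun v => ?_
  rw [inner_gradient_left, LinearIsometryEquiv.inner_map_eq_flip, LinearIsometryEquiv.symm_symm,
    inner_gradient_left]
  have h := ((hw.differentiable (by simp) (planeRot α z)).hasFDerivAt.comp z
    (planeRot α).toContinuousLinearEquiv.hasFDerivAt).fderiv
  exact congrArg (fun L => L v) h

theorem contDiff_comp_planeRot (α : Bdry) {w : ℂ → ℝ} (hw : ContDiff ℝ ∞ w) :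
    ContDiff ℝ ∞ fun z => w (planeRot α z) :=
  hw.comp (planeRot α).toContinuousLinearEquiv.contDiff

theorem rotTriple_smoothTriple (α : Bdry) {w : ℂ → ℝ} (hw : ContDiff ℝ ∞ w) :
    rotTriple α (smoothTriple w hw) = smoothTriple (fun z => w (planeRot α z))
      (contDiff_comp_planeRot α hw) := by
  have hw' := contDiff_comp_planeRot α hw
  have hρ := measurePreserving_planeRot α
  have hs := measurePreserving_shift α
  have e1 : rotFun α ((memLp_disk hw.continuous).toLp w) = (memLp_disk hw'.continuous).toLp _ := by
    ext1
    filter_upwards [coeFn_rotFun α ((memLp_disk hw.continuous).toLp w),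
      (memLp_disk hw'.continuous).coeFn_toLp,
      hρ.quasiMeasurePreserving.ae (memLp_disk hw.continuous).coeFn_toLp] with z h1 h2 h3
    rw [h1, h3, h2]
  have e2 : rotField α ((memLp_disk (continuous_gradient hw)).toLp _)
      = (memLp_disk (continuous_gradient hw')).toLp _ := by
    ext1
    filter_upwards [coeFn_rotField α ((memLp_disk (continuous_gradient hw)).toLp _),
      (memLp_disk (continuous_gradient hw')).coeFn_toLp,
      hρ.quasiMeasurePreserving.ae (memLp_disk (continuous_gradient hw)).coeFn_toLp]
      with z h1 h2 h3
    rw [h1, h3, ← gradient_comp_planeRot α hw, h2]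
  have e3 : shift α ((memLp_trace hw).toLp _) = (memLp_trace hw').toLp _ := by
    ext1
    filter_upwards [coeFn_shift α ((memLp_trace hw).toLp _), (memLp_trace hw').coeFn_toLp,
      hs.quasiMeasurePreserving.ae (memLp_trace hw).coeFn_toLp] with θ h1 h2 h3
    rw [h1, h3, ← planeRot_bdryPoint, h2]
  simp only [rotTriple, smoothTriple, funL_triple, gradL_triple, traceL_triple, e1, e2, e3]

theorem rotTriple_mem (α : Bdry) {x : TripleSpace} (hx : x ∈ traceSpace) :
    rotTriple α x ∈ traceSpace := by
  refine map_mem_closure (continuous_rotTriple α) hx ?_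
  rintro _ ⟨w, hw, rfl⟩
  exact ⟨_, _, (rotTriple_smoothTriple α hw).symm⟩

theorem IsRotationallySymmetric.ae_comp_planeRot {σ : ℂ → ℝ} (h : IsRotationallySymmetric σ)
    (α : Bdry) : ∀ᵐ z ∂diskMeasure, σ (planeRot α z) = σ z := by
  obtain ⟨ρ, hρ⟩ := h
  filter_upwards [hρ, (measurePreserving_planeRot α).quasiMeasurePreserving.ae hρ] with z h1 h2
  rw [h1, h2, LinearIsometryEquiv.norm_map]

/-- A change of variables by the rotation, which leaves `σ` invariant. -/
theorem energy_rotField {σ : ℂ → ℝ} (h : IsRotationallySymmetric σ) (α : Bdry)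
    (G F : L2DiskVec) : energy σ (rotField α G) F = energy σ G (rotField (-α) F) := by
  have e1 : energy σ G (rotField (-α) F)
      = ∫ z, σ z * inner ℝ (G z) (planeRot α (F ((planeRot α).symm z))) ∂diskMeasure := by
    refine integral_congr_ae ?_
    filter_upwards [coeFn_rotField (-α) F] with z hz
    rw [hz, ← planeRot_symm, LinearIsometryEquiv.symm_symm]
  rw [e1, ← (measurePreserving_planeRot α).integral_comp
    (planeRot α).toHomeomorph.measurableEmbedding]
  refine integral_congr_ae ?_
  filter_upwards [coeFn_rotField α G, h.ae_comp_planeRot α] with z h1 h2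
  rw [h1, h2, LinearIsometryEquiv.symm_apply_apply, LinearIsometryEquiv.inner_map_eq_flip,
    LinearIsometryEquiv.symm_symm]

theorem inner_shift (α : Bdry) (f g : L2Bdry) :
    inner ℝ (shift α f) g = inner ℝ f (shift (-α) g) := by
  have e1 : inner ℝ f (shift (-α) g) = ∫ θ, inner ℝ (f θ) (g (θ + -α)) := by
    rw [L2.inner_def]
    refine integral_congr_ae ?_
    filter_upwards [coeFn_shift (-α) g] with z hz
    rw [hz]
  rw [e1, ← (measurePreserving_shift α).integral_comp (measurableEmbedding_addRight α),
    L2.inner_def]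
  refine integral_congr_ae ?_
  filter_upwards [coeFn_shift α f] with z h1
  rw [h1, add_neg_cancel_right]

theorem MeanFree.shift {g : L2Bdry} (h : MeanFree g) (α : Bdry) : MeanFree (shift α g) := by
  rw [MeanFree, integral_congr_ae (coeFn_shift α g)]
  rw [(measurePreserving_shift α).integral_comp (measurableEmbedding_addRight α)]
  exact h

/-- The Neumann-to-Dirichlet map of a rotationally symmetric conductivity commutes with
rotations. -/
theorem IsVoltage.shift {σ : ℂ → ℝ} (hrot : IsRotationallySymmetric σ) {ψ g : L2Bdry}
    (h : IsVoltage σ ψ g) (α : Bdry) : IsVoltage σ (shift α ψ) (shift α g) := by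
  obtain ⟨hm, x, hx, rfl, he⟩ := isVoltage_iff.1 h
  refine isVoltage_iff.2 ⟨hm.shift α, rotTriple α x, rotTriple_mem α hx, rfl, fun y hy => ?_⟩
  have h1 := he _ (rotTriple_mem (-α) hy)
  rw [inner_shift]
  exact (energy_rotField hrot α _ _).trans h1

/-! ### The trigonometric basis -/

theorem integral_fourier_eq (n : ℤ) :
    ∫ θ : Bdry, (fourier n θ : ℂ) = if n = 0 then 2 * (π : ℂ) else 0 := by
  split_ifs with h
  · subst h
    have := Real.pi_pos
    simp only [fourier_zero, integral_const, Measure.real, AddCircle.measure_univ]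
    rw [ENNReal.toReal_ofReal (by positivity)]
    simp
  · have h1 : ∫ θ : Bdry, (fourier n (θ + ((2 * π / 2 / n : ℝ) : Bdry)) : ℂ)
        = ∫ θ : Bdry, (fourier n θ : ℂ) := integral_add_right_eq_self _ _
    simp_rw [fourier_add_half_inv_index h Real.two_pi_pos] at h1
    -- translation by half a period changes the sign of the integrand
    rw [integral_neg] at h1
    exact self_eq_neg.1 h1.symm

theorem integrable_of_continuous_bdry {F : Type*} [NormedAddCommGroup F] {f : Bdry → F}
    (hf : Continuous f) : Integrable f :=
  hf.integrable_of_hasCompactSupport (HasCompactSupport.of_compactSpace f)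

theorem integral_fourier_re (n : ℤ) :
    ∫ θ : Bdry, (fourier n θ : ℂ).re = if n = 0 then 2 * π else 0 := by
  have h := integral_re (integrable_of_continuous_bdry (fourier n).continuous)
  rw [integral_fourier_eq] at h
  refine (h : _ = _).trans ?_
  split_ifs <;> simp

theorem integral_fourier_im (n : ℤ) : ∫ θ : Bdry, (fourier n θ : ℂ).im = 0 := by
  have h := integral_im (integrable_of_continuous_bdry (fourier n).continuous)
  rw [integral_fourier_eq] at h
  refine (h : _ = _).trans ?_
  split_ifs <;> simp

theorem coeFn_basisFun (n : ℤ) : basisFun n =ᵐ[volume] trigFun n :=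
  ContinuousMap.coeFn_toLp volume _

theorem meanFree_basisFun {n : ℤ} (hn : n ≠ 0) : MeanFree (basisFun n) := by
  rw [MeanFree, integral_congr_ae (coeFn_basisFun n)]
  simp only [trigFun, ContinuousMap.coe_mk]
  rw [integral_const_mul]
  split_ifs
  · rw [integral_fourier_im, mul_zero]
  · rw [integral_fourier_re, if_neg hn, mul_zero]

theorem inner_basisFun {j l : ℤ} (hl : l ≠ 0) :
    inner ℝ (basisFun j) (basisFun l) = if j = l then (1 : ℝ) else 0 := by
  have hpi := Real.pi_pos
  have e1 : inner ℝ (basisFun j) (basisFun l) = ∫ θ, trigFun j θ * trigFun l θ := by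
    rw [L2.inner_def]
    refine integral_congr_ae ?_
    filter_upwards [coeFn_basisFun j, coeFn_basisFun l] with θ h1 h2
    rw [h1, h2]
    simp [mul_comm]
  have hs : (1 / √π) * (1 / √π) = 1 / π := by
    rw [div_mul_div_comm, one_mul, Real.mul_self_sqrt hpi.le]
  have ir : ∀ n : ℤ, Integrable fun θ : Bdry => (fourier n θ : ℂ).re := fun n =>
    integrable_of_continuous_bdry (by fun_prop)
  have ii : ∀ n : ℤ, Integrable fun θ : Bdry => (fourier n θ : ℂ).im := fun n =>
    integrable_of_continuous_bdry (by fun_prop)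
  have hp : ∀ θ : Bdry, (fourier (j + l) θ : ℂ) = fourier j θ * fourier l θ := fun θ => fourier_add
  have hm : ∀ θ : Bdry, (fourier (j - l) θ : ℂ) = fourier j θ * (starRingEnd ℂ) (fourier l θ) :=
    fun θ => by rw [sub_eq_add_neg, fourier_add, fourier_neg]
  rw [e1]
  by_cases h1 : j < 0 <;> by_cases h2 : l < 0
  · have : ∀ θ, trigFun j θ * trigFun l θ
        = 1 / (2 * π) * ((fourier (j - l) θ : ℂ).re - (fourier (j + l) θ : ℂ).re) := by
      intro θ
      simp only [trigFun, ContinuousMap.coe_mk, if_pos h1, if_pos h2, hp, hm, Complex.mul_re,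
        Complex.conj_re, Complex.conj_im]
      linear_combination ((fourier j θ : ℂ).im * (fourier l θ : ℂ).im) * hs
    simp_rw [this]
    rw [integral_const_mul, integral_sub (ir _) (ir _), integral_fourier_re, integral_fourier_re,
      if_neg (by omega : ¬ j + l = 0)]
    simp only [sub_eq_zero]
    split_ifs
    · field_simp; ring
    · simp
  · have : ∀ θ, trigFun j θ * trigFun l θ
        = 1 / (2 * π) * ((fourier (j - l) θ : ℂ).im + (fourier (j + l) θ : ℂ).im) := by
      intro θ
      simp only [trigFun, ContinuousMap.coe_mk, if_pos h1, if_neg h2, hp, hm, Complex.mul_im,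
        Complex.conj_re, Complex.conj_im]
      linear_combination ((fourier j θ : ℂ).im * (fourier l θ : ℂ).re) * hs
    simp_rw [this]
    rw [integral_const_mul, integral_add (ii _) (ii _), integral_fourier_im, integral_fourier_im,
      if_neg (by omega)]
    simp
  · have : ∀ θ, trigFun j θ * trigFun l θ
        = 1 / (2 * π) * ((fourier (j + l) θ : ℂ).im - (fourier (j - l) θ : ℂ).im) := by
      intro θ
      simp only [trigFun, ContinuousMap.coe_mk, if_neg h1, if_pos h2, hp, hm, Complex.mul_im,
        Complex.conj_re, Complex.conj_im]
      linear_combination ((fourier j θ : ℂ).re * (fourier l θ : ℂ).im) * hs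
    simp_rw [this]
    rw [integral_const_mul, integral_sub (ii _) (ii _), integral_fourier_im, integral_fourier_im,
      if_neg (by omega)]
    simp
  · have : ∀ θ, trigFun j θ * trigFun l θ
        = 1 / (2 * π) * ((fourier (j - l) θ : ℂ).re + (fourier (j + l) θ : ℂ).re) := by
      intro θ
      simp only [trigFun, ContinuousMap.coe_mk, if_neg h1, if_neg h2, hp, hm, Complex.mul_re,
        Complex.conj_re, Complex.conj_im]
      linear_combination ((fourier j θ : ℂ).re * (fourier l θ : ℂ).re) * hs
    simp_rw [this]
    rw [integral_const_mul, integral_add (ir _) (ir _), integral_fourier_re, integral_fourier_re,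
      if_neg (by omega : ¬ j + l = 0)]
    simp only [sub_eq_zero]
    split_ifs
    · field_simp; ring
    · simp

/-- Addition theorem for sine and cosine. -/
theorem trigFun_add {j : ℤ} (hj : j ≠ 0) (θ α : Bdry) :
    trigFun j (θ + α) = (fourier j α : ℂ).re * trigFun j θ
      + (fourier j α : ℂ).im * trigFun (-j) θ := by
  have h : (fourier j (θ + α) : ℂ) = fourier j θ * fourier j α := by
    simp only [fourier_apply, smul_add, AddCircle.toCircle_add, Circle.coe_mul]
  simp only [trigFun, ContinuousMap.coe_mk, h, fourier_neg, Complex.conj_re, Complex.conj_im,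
    Complex.mul_re, Complex.mul_im]
  rcases lt_or_gt_of_ne hj with h1 | h1
  · simp only [if_pos h1, if_neg (by omega : ¬ -j < 0)]
    ring
  · simp only [if_neg (by omega : ¬ j < 0), if_pos (by omega : -j < 0)]
    ring

theorem shift_basisFun {j : ℤ} (hj : j ≠ 0) (α : Bdry) :
    shift α (basisFun j) = (fourier j α : ℂ).re • basisFun j
      + (fourier j α : ℂ).im • basisFun (-j) := by
  ext1
  filter_upwards [coeFn_shift α (basisFun j), Lp.coeFn_add ((fourier j α : ℂ).re • basisFun j)
      ((fourier j α : ℂ).im • basisFun (-j)), Lp.coeFn_smul (fourier j α : ℂ).re (basisFun j),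
      Lp.coeFn_smul (fourier j α : ℂ).im (basisFun (-j)), coeFn_basisFun j, coeFn_basisFun (-j),
      (measurePreserving_shift α).quasiMeasurePreserving.ae (coeFn_basisFun j)]
    with θ h1 h2 h3 h4 h5 h6 h7
  rw [h1, h2, Pi.add_apply, h3, h4, Pi.smul_apply, Pi.smul_apply, h5, h6, h7, trigFun_add hj]
  rfl

/-! ### Eigenfunctions of rotation equivariant maps -/

theorem exists_trigFun_eq {j : ℤ} (hj : j ≠ 0) (x y : ℝ) : ∃ a b : ℝ, ∀ θ : Bdry,
    x * (fourier j θ : ℂ).re + y * (fourier j θ : ℂ).im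
      = a * trigFun j θ + b * trigFun (-j) θ := by
  have hpi : √π ≠ 0 := (Real.sqrt_pos.2 Real.pi_pos).ne'
  rcases lt_or_gt_of_ne hj with h1 | h1
  · refine ⟨√π * y, √π * x, fun θ => ?_⟩
    simp only [trigFun, ContinuousMap.coe_mk, fourier_neg, Complex.conj_re]
    rw [if_pos h1, if_neg (by omega : ¬ -j < 0)]
    field_simp
    ring
  · refine ⟨√π * x, -(√π * y), fun θ => ?_⟩
    simp only [trigFun, ContinuousMap.coe_mk, fourier_neg, Complex.conj_im]
    rw [if_neg (by omega : ¬ j < 0), if_pos (by omega : -j < 0)]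
    field_simp

/-- A function whose translates by `α` are the combinations with coefficients `cos jα`, `sin jα` of
two fixed functions is a combination of `cos jθ` and `sin jθ`. -/
theorem exists_eq_of_shift_eq {j : ℤ} (hj : j ≠ 0) {g h : L2Bdry}
    (hs : ∀ α : Bdry, shift α g = (fourier j α : ℂ).re • g + (fourier j α : ℂ).im • h) :
    ∃ a b : ℝ, g = a • basisFun j + b • basisFun (-j) := by
  have hpi := Real.pi_pos
  have mg := (Lp.stronglyMeasurable g).measurable
  have mh := (Lp.stronglyMeasurable h).measurable
  have h1 : ∀ᵐ α : Bdry, ∀ᵐ θ : Bdry,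
      g (θ + α) = (fourier j α : ℂ).re * g θ + (fourier j α : ℂ).im * h θ := by
    refine ae_of_all _ fun α => ?_
    have h0 := coeFn_shift α g
    rw [hs α] at h0
    filter_upwards [h0, Lp.coeFn_add ((fourier j α : ℂ).re • g) ((fourier j α : ℂ).im • h),
      Lp.coeFn_smul (fourier j α : ℂ).re g, Lp.coeFn_smul (fourier j α : ℂ).im h] with θ a1 a2 a3 a4
    rw [← a1, a2, Pi.add_apply, a3, a4]
    rfl
  rw [Measure.ae_ae_comm] at h1
  swap
  · have c : Measurable fun α : Bdry => (fourier j α : ℂ) := (fourier j).continuous.measurable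
    exact measurableSet_eq_fun (by fun_prop) (by fun_prop)
  -- a base point `θ₀` for which the relation holds at almost every `α` determines `g`
  obtain ⟨θ₀, h2⟩ := h1.exists
  obtain ⟨a, b, hab⟩ := exists_trigFun_eq hj
    (g θ₀ * (fourier j θ₀ : ℂ).re - h θ₀ * (fourier j θ₀ : ℂ).im)
    (g θ₀ * (fourier j θ₀ : ℂ).im + h θ₀ * (fourier j θ₀ : ℂ).re)
  refine ⟨a, b, ?_⟩
  ext1
  filter_upwards [(measurePreserving_shift (-θ₀)).quasiMeasurePreserving.ae h2,
    Lp.coeFn_add (a • basisFun j) (b • basisFun (-j)), Lp.coeFn_smul a (basisFun j),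
    Lp.coeFn_smul b (basisFun (-j)), coeFn_basisFun j, coeFn_basisFun (-j)]
    with β a1 a2 a3 a4 a5 a6
  have hf : (fourier j (β + -θ₀) : ℂ) = fourier j β * (starRingEnd ℂ) (fourier j θ₀) := by
    rw [← fourier_neg, fourier_apply, fourier_apply, fourier_apply, smul_add,
      AddCircle.toCircle_add, Circle.coe_mul, smul_neg, neg_smul]
  rw [add_comm β, add_neg_cancel_left, add_comm _ β, hf] at a1
  rw [a1, a2, Pi.add_apply, a3, a4, Pi.smul_apply, Pi.smul_apply, a5, a6, smul_eq_mul, smul_eq_mul,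
    ← hab β, Complex.mul_re, Complex.mul_im, Complex.conj_re, Complex.conj_im]
  ring

theorem exists_fourier_eq_I {j : ℤ} (hj : j ≠ 0) : ∃ α : Bdry, (fourier j α : ℂ) = Complex.I := by
  refine ⟨((π / (2 * j) : ℝ) : Bdry), ?_⟩
  have h2 : (j : ℂ) ≠ 0 := by exact_mod_cast hj
  have h1 : (π : ℂ) ≠ 0 := by exact_mod_cast Real.pi_ne_zero
  rw [fourier_coe_apply]
  refine (congrArg Complex.exp ?_).trans Complex.exp_pi_div_two_mul_I
  push_cast
  field_simp

/-- The trigonometric functions are eigenfunctions of the Neumann-to-Dirichlet map of a rotationally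
symmetric conductivity. -/
theorem exists_ndMap_basisFun {σ : ℂ → ℝ} (hσ : IsConductivity σ)
    (hrot : IsRotationallySymmetric σ) {j : ℤ} (hj : j ≠ 0) :
    ∃ c : ℝ, ndMap σ (basisFun j) = c • basisFun j := by
  have hj' : -j ≠ 0 := neg_ne_zero.2 hj
  have v1 := isVoltage_ndMap hσ (meanFree_basisFun hj)
  have v2 := isVoltage_ndMap hσ (meanFree_basisFun hj')
  set g := ndMap σ (basisFun j)
  set h := ndMap σ (basisFun (-j))
  have hs : ∀ α : Bdry, shift α g = (fourier j α : ℂ).re • g + (fourier j α : ℂ).im • h := by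
    intro α
    have v3 := v1.shift hrot α
    rw [shift_basisFun hj] at v3
    exact v3.unique hσ ((v1.smul _).add hσ (v2.smul _))
  obtain ⟨a, b, hab⟩ := exists_eq_of_shift_eq hj hs
  obtain ⟨α, hα⟩ := exists_fourier_eq_I hj
  -- the translation by a quarter period expresses `h` through `g`
  have hh : h = a • basisFun (-j) - b • basisFun j := by
    have e := hs α
    rw [hab, map_add, map_smul, map_smul, shift_basisFun hj, shift_basisFun hj', neg_neg,
      fourier_neg, hα] at e
    simp only [Complex.conj_I, Complex.neg_re, Complex.neg_im, Complex.I_re, Complex.I_im, neg_zero,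
      zero_smul, one_smul, zero_add, smul_neg, neg_smul] at e
    rw [← e, sub_eq_add_neg]
  have hb := v1.inner_comm v2
  rw [hh, hab, inner_sub_right, inner_add_right, inner_smul_right, inner_smul_right,
    inner_smul_right, inner_smul_right, inner_basisFun hj, inner_basisFun hj', inner_basisFun hj,
    inner_basisFun hj', if_neg (by omega : ¬ j = -j), if_neg (by omega : ¬ -j = j), if_pos rfl,
    if_pos rfl] at hb
  have hb0 : b = 0 := by linarith
  exact ⟨a, by rw [hab, hb0, zero_smul, add_zero]⟩

/-! ### Electrodes -/

/-- Away from a point `p ∉ S`, the circle is an open interval, in which `S` becomes convex. -/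
theorem volume_frontier_eq_zero {S : Set Bdry} (hS : IsOpen S) (hc : IsPreconnected S) :
    volume (frontier S) = 0 := by
  by_cases hu : S = Set.univ
  · rw [hu, frontier_univ, measure_empty]
  obtain ⟨p, hp⟩ := (Set.ne_univ_iff_exists_notMem S).1 hu
  obtain ⟨a, rfl⟩ := QuotientAddGroup.mk_surjective p
  let e := AddCircle.openPartialHomeomorphCoe (2 * π) a
  have hST : S ⊆ e.target := fun x hx h => hp (h ▸ hx)
  have hJ : IsPreconnected (e.symm '' S) := hc.image _ (e.continuousOn_symm.mono hST)
  have hJ0 : volume (frontier (e.symm '' S)) = 0 :=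
    hJ.ordConnected.convex.addHaar_frontier volume
  have hmp := AddCircle.measurePreserving_mk (2 * π) a
  rw [← hmp.measure_preimage isClosed_frontier.measurableSet.nullMeasurableSet,
    Measure.restrict_apply' measurableSet_Ioc]
  refine measure_mono_null (t := frontier (e.symm '' S) ∪ {a + 2 * π}) ?_
    (measure_union_null hJ0 (measure_singleton _))
  rintro t ⟨ht, htI⟩
  by_cases hta : t = a + 2 * π
  · exact Or.inr hta
  left
  have hts : t ∈ e.source := ⟨htI.1, lt_of_le_of_ne htI.2 hta⟩
  have htt : e t ∈ e.target := e.map_source hts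
  have het : e.symm (e t) = t := e.left_inv hts
  have htf : e t ∈ frontier S := ht
  rw [hS.frontier_eq] at htf
  have h1 : t ∈ closure (e.symm '' S) := by
    rw [← het]
    exact mem_closure_image (e.continuousAt_symm htt) htf.1
  refine ⟨h1, fun h => ?_⟩
  obtain ⟨y, hy, hyt⟩ := interior_subset h
  apply htf.2
  rw [← hyt, e.right_inv (hST hy)]
  exact hy

theorem ElectrodeArray.iUnion_ext_ae_eq_univ {M : ℕ} (A : ElectrodeArray M) :
    (⋃ m, A.Ext m : Set Bdry) =ᵐ[volume] Set.univ := by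
  rw [ae_eq_univ]
  refine measure_mono_null (t := ⋃ m, frontier (A.Ext m)) ?_ (measure_iUnion_null fun m =>
    volume_frontier_eq_zero (A.isOpen_Ext m) (A.isConnected_Ext m).isPreconnected)
  intro x hx
  have h : x ∈ ⋃ m, closure (A.Ext m) := A.cover ▸ Set.mem_univ x
  obtain ⟨m, hm⟩ := Set.mem_iUnion.1 h
  refine Set.mem_iUnion.2 ⟨m, ?_⟩
  rw [(A.isOpen_Ext m).frontier_eq]
  exact ⟨hm, fun h' => hx (Set.mem_iUnion.2 ⟨m, h'⟩)⟩

/-- The integral of `Q φ` is the sum of the integrals of `φ` over the extended electrodes, which is the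
integral over the whole circle. -/
theorem ElectrodeArray.meanFree_Q {M : ℕ} (A : ElectrodeArray M) {φ : L2Bdry} (hφ : MeanFree φ) :
    MeanFree (A.Q φ) := by
  have hint : Integrable φ := (Lp.memLp φ).integrable (by norm_num)
  have h1 : ∀ m, meanL ((((volume : Measure Bdry).real (A.E m))⁻¹ * ∫ θ in A.Ext m, φ θ) •
      indicatorConstLp 2 (A.isOpen_E m).measurableSet (measure_ne_top volume (A.E m)) (1 : ℝ))
      = (2 * π)⁻¹ * ∫ θ in A.Ext m, φ θ := by
    intro m
    have hpos : (volume : Measure Bdry).real (A.E m) ≠ 0 :=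
      (ENNReal.toReal_pos ((A.isOpen_E m).measure_pos volume (A.isConnected_E m).nonempty).ne'
        (measure_ne_top _ _)).ne'
    rw [map_smul, meanL_apply, integral_indicatorConstLp, smul_eq_mul, smul_eq_mul]
    field_simp
  rw [meanFree_iff, ElectrodeArray.Q, map_sum, Finset.sum_congr rfl fun m _ => h1 m,
    ← Finset.mul_sum, ← integral_iUnion_fintype (fun m => (A.isOpen_Ext m).measurableSet)
      A.disjoint_Ext fun m => hint.integrableOn,
    setIntegral_congr_set A.iUnion_ext_ae_eq_univ, setIntegral_univ, hφ, mul_zero]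

/-! ### The difference map -/

theorem indexSet_ne_zero {N : ℕ} (j : indexSet N) : (j : ℤ) ≠ 0 :=
  (Finset.mem_erase.1 j.2).1

theorem isRotationallySymmetric_one : IsRotationallySymmetric fun _ => 1 :=
  ⟨fun _ => 1, ae_of_all _ fun _ => rfl⟩

theorem exists_ndDiff_basisFun {σ : ℂ → ℝ} (hσ : IsConductivity σ)
    (hrot : IsRotationallySymmetric σ) {j : ℤ} (hj : j ≠ 0) :
    ∃ c : ℝ, ndDiff σ (basisFun j) = c • basisFun j := by
  obtain ⟨a, ha⟩ := exists_ndMap_basisFun hσ hrot hj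
  obtain ⟨b, hb⟩ := exists_ndMap_basisFun isConductivity_one isRotationallySymmetric_one hj
  exact ⟨a - b, by rw [ndDiff, ha, hb, sub_smul]⟩

theorem inner_ndDiff_comm {σ : ℂ → ℝ} (hσ : IsConductivity σ) {ψ φ : L2Bdry} (hψ : MeanFree ψ)
    (hφ : MeanFree φ) : inner ℝ (ndDiff σ ψ) φ = inner ℝ ψ (ndDiff σ φ) := by
  have h1 := (isVoltage_ndMap hσ hψ).inner_comm (isVoltage_ndMap hσ hφ)
  have h2 := (isVoltage_ndMap isConductivity_one hψ).inner_comm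
    (isVoltage_ndMap isConductivity_one hφ)
  rw [ndDiff, ndDiff, inner_sub_left, inner_sub_right, h1, h2, real_inner_comm φ,
    real_inner_comm φ]

/-- If `R φ_j = c φ_j`, then the `j`-th coefficient of `R ψ` is `c` times that of `ψ`. -/
theorem ndDiff_basisFun_eq {σ : ℂ → ℝ} (hσ : IsConductivity σ)
    (hrot : IsRotationallySymmetric σ) {j : ℤ} (hj : j ≠ 0) {ψ : L2Bdry} (hψ : MeanFree ψ)
    (h0 : coeff ψ j ≠ 0) :
    ndDiff σ (basisFun j) = (coeff (ndDiff σ ψ) j / coeff ψ j) • basisFun j := by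
  obtain ⟨c, hc⟩ := exists_ndDiff_basisFun hσ hrot hj
  have h : coeff (ndDiff σ ψ) j = c * coeff ψ j := by
    rw [coeff, inner_ndDiff_comm hσ hψ (meanFree_basisFun hj), hc, inner_smul_right, coeff]
  rw [h, mul_div_cancel_right₀ _ h0, hc]

end EIT

end

theorem corollary3p2 (σ : ℂ → ℝ) (hσ : EIT.IsConductivity σ)
    (hrot : EIT.IsRotationallySymmetric σ) (hone : EIT.IsOneNearBoundary σ)
    (M : ℕ) (A : EIT.ElectrodeArray M) (N : ℕ) (hN : Even N) (hNM : N < M)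
    (hΨ : (A.Psi N).rank = N ^ 2)
    (n : EIT.indexSet N) (hn : ∀ j : EIT.indexSet N, EIT.coeff (A.current n) j ≠ 0) :
    -- the maps `R_σ` and `R_1` are well defined on mean free currents, and `ψ_n` is one
    (∀ ψ : EIT.L2Bdry, EIT.MeanFree ψ →
      (∃! g, EIT.IsVoltage σ ψ g) ∧ (∃! g, EIT.IsVoltage (fun _ => 1) ψ g)) ∧
    EIT.MeanFree (A.current n) ∧
    -- the eigenvalues are the quotients of the coefficients of `g_n = R_{σ,1} ψ_n` and of `ψ_n`
    (∀ j : EIT.indexSet N, EIT.ndDiff σ (EIT.basisFun j) =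
      (EIT.coeff (EIT.ndDiff σ (A.current n)) j / EIT.coeff (A.current n) j) •
        EIT.basisFun j) ∧
    -- the whole matrix is recovered from the same quotients
    EIT.ndMatrix σ N = Matrix.diagonal (fun j : EIT.indexSet N =>
      EIT.coeff (EIT.ndDiff σ (A.current n)) j / EIT.coeff (A.current n) j) := by
  have hcur : EIT.MeanFree (A.current n) :=
    A.meanFree_Q (EIT.meanFree_basisFun (EIT.indexSet_ne_zero n))
  have heig := fun j : EIT.indexSet N =>
    EIT.ndDiff_basisFun_eq hσ hrot (EIT.indexSet_ne_zero j) hcur (hn j)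
  refine ⟨fun ψ hψ => ⟨EIT.existsUnique_isVoltage hσ hψ,
    EIT.existsUnique_isVoltage EIT.isConductivity_one hψ⟩, hcur, heig, ?_⟩
  ext k j
  rw [EIT.ndMatrix, Matrix.of_apply, EIT.coeff, heig k, inner_smul_left,
    EIT.inner_basisFun (EIT.indexSet_ne_zero j), Matrix.diagonal_apply]
  by_cases h : k = j
  · subst h
    simp
  · rw [if_neg fun h' => h (Subtype.ext h'), if_neg h, mul_zero]
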